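/- For a Dirichlet series $f(s)=\sum_{n\ge 1} a_n n^{-s}$ let $\sigma_a$ (resp. $\sigma_c$) be the infimum of the real $\sigma$ such that the series converges absolutely (resp. converges) at every $s$ with $\Re s>\sigma$, and let $\sigma_b$ be the infimum of the real $\sigma$ such that the series converges to a bounded function on $\{\Re s>\sigma\}$. Let $p_k$ denote the $k$-th prime. Let $\rho_1\in(0,1)$ and put $X=\tfrac23(\rho_1+2)$. For $L\ge 1$ put $r_1=r_1(L)=\lfloor 2^{\rho_1L}\rfloor$ and $\omega_L=e^{2\pi i/2^L}$. Given complex numbers $\beta_L$ with $|\beta_L|=1$ for all $L$, define $$a_n=\beta_L\,2^{-XL}\,\omega_L^{\,i_1i_2}\,\omega_L^{\,i_2i_3}\qquad\text{if } n=p_{3\cdot2^L+i_1}\;p_{4\cdot2^L+i_2}\;p_{5\cdot2^L+i_3}$$ for some $L\ge1$, $0\le i_1<r_1$, $0\le i_2,i_3<2^L$ (such $L,i_1,i_2,i_3$ are unique if they exist), and $a_n=0$ for all other $n$. Then the unimodular numbers $\beta_L$ can be chosen so that the Dirichlet series $\sum a_nn^{-s}$ is $3$-homogeneous (that is, $a_n\ne0$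 only if $n$ has exactly three prime factors, counted with multiplicity), its three abscissae are finite, and $$0\le\sigma_b\le\frac{1-\rho_1}{18},\qquad \sigma_a\ge\frac{\rho_1+2}{9},\qquad \sigma_c\le\frac{\rho_1-1}{9}.$$ Consequently $$\sigma_a-\sigma_c\ge\frac13,\qquad \sigma_a-\sigma_b\ge\frac{1+\rho_1}{6},\qquad \sigma_b-\sigma_c\ge\frac{1-\rho_1}{9};$$ in particular, if $\rho_1>1/2$ then $\sigma_a-\sigma_b>\tfrac14$. -/

import Mathlib

open Filter Topology

namespace BohrStrip

/-- `∑_{n=1}^{N} a_n n^{-s}`. -/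
noncomputable def partialSum (a : ℕ → ℂ) (s : ℂ) (N : ℕ) : ℂ :=
  ∑ n ∈ Finset.Icc 1 N, a n * (n : ℂ) ^ (-s)

/-- The abscissa of convergence `σ_c`: the infimum of the real `σ` such that `∑ a_n n^{-s}`
converges for all `s` with `Re s > σ`. -/
noncomputable def abscissaOfConv (a : ℕ → ℂ) : EReal :=
  sInf (Real.toEReal '' {σ : ℝ | ∀ s : ℂ, σ < s.re →
    ∃ l : ℂ, Tendsto (partialSum a s) atTop (𝓝 l)})

/-- The abscissa of boundedness `σ_b`: the infimum of the real `σ` such that `∑ a_n n^{-s}`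
converges to a bounded function on `Re s > σ`. -/
noncomputable def abscissaOfBdd (a : ℕ → ℂ) : EReal :=
  sInf (Real.toEReal '' {σ : ℝ | ∃ (f : ℂ → ℂ) (C : ℝ), ∀ s : ℂ, σ < s.re →
    Tendsto (partialSum a s) atTop (𝓝 (f s)) ∧ ‖f s‖ ≤ C})

/-- Every term has exactly `M` prime factors, counted with multiplicity. -/
def IsHomogeneous (M : ℕ) (a : ℕ → ℂ) : Prop :=
  ∀ n : ℕ, a n ≠ 0 → n ≠ 0 ∧ ArithmeticFunction.cardFactors n = M

/-- The `k`-th prime, `k ≥ 1` (so `kthPrime 1 = 2`). -/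
noncomputable def kthPrime (k : ℕ) : ℕ := Nat.nth Nat.Prime (k - 1)

/-- The product `p_{3·2^L+i₁} p_{4·2^L+i₂} p_{5·2^L+i₃}`. -/
noncomputable def node (L i₁ i₂ i₃ : ℕ) : ℕ :=
  kthPrime (3 * 2 ^ L + i₁) * kthPrime (4 * 2 ^ L + i₂) * kthPrime (5 * 2 ^ L + i₃)

/-- The size `r₁ = ⌊2^{ρ₁ L}⌋` of the first set of primes at level `L`; the other two
have `r₂ = r₃ = 2^L` elements. -/
noncomputable def firstSize (ρ₁ : ℝ) (L : ℕ) : ℕ := ⌊(2 : ℝ) ^ (ρ₁ * L)⌋₊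

/-- The primitive root of unity `exp (2πi / r)`. -/
noncomputable def rootOfUnity (r : ℕ) : ℂ := Complex.exp (2 * Real.pi * Complex.I / r)

/-- `β_L 2^{-X L} ω^{i₁ i₂} ω^{i₂ i₃}` with `X = 2(ρ₁ + 2)/3` and `ω = exp (2πi / 2^L)`. -/
noncomputable def nodeCoeff (ρ₁ : ℝ) (β : ℕ → ℂ) (L i₁ i₂ i₃ : ℕ) : ℂ :=
  β L * (((2 : ℝ) ^ (-(2 * (ρ₁ + 2) / 3) * L) : ℝ) : ℂ) *
    rootOfUnity (2 ^ L) ^ (i₁ * i₂) * rootOfUnity (2 ^ L) ^ (i₂ * i₃)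

/-- The coefficients `a_n`: `a_n = nodeCoeff ρ₁ β L i₁ i₂ i₃` if `n = node L i₁ i₂ i₃` with
`L ≥ 1`, `0 ≤ i₁ < r₁`, `0 ≤ i₂, i₃ < 2^L`, and `a_n = 0` otherwise. At most one term of the sum
is nonzero, and the restriction `L ≤ n` loses nothing; see `coeff_node` and `coeff_eq_zero`. -/
noncomputable def coeff (ρ₁ : ℝ) (β : ℕ → ℂ) (n : ℕ) : ℂ :=
  ∑ L ∈ Finset.Icc 1 n, ∑ i₁ ∈ Finset.range (firstSize ρ₁ L),
    ∑ i₂ ∈ Finset.range (2 ^ L), ∑ i₃ ∈ Finset.range (2 ^ L),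
      if n = node L i₁ i₂ i₃ then nodeCoeff ρ₁ β L i₁ i₂ i₃ else 0

theorem kthPrime_prime (k : ℕ) : (kthPrime k).Prime := Nat.prime_nth_prime _

theorem kthPrime_lt {k l : ℕ} (hk : 1 ≤ k) (h : k < l) : kthPrime k < kthPrime l :=
  Nat.nth_strictMono Nat.infinite_setOfPred_prime (by omega)

theorem kthPrime_inj {k l : ℕ} (hk : 1 ≤ k) (hl : 1 ≤ l) (h : kthPrime k = kthPrime l) :
    k = l := by
  rcases lt_trichotomy k l with h1 | h1 | h1
  · exact absurd h (kthPrime_lt hk h1).ne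
  · exact h1
  · exact absurd h (kthPrime_lt hl h1).ne'

theorem firstSize_le {ρ₁ : ℝ} (hρ : ρ₁ ≤ 1) (L : ℕ) : firstSize ρ₁ L ≤ 2 ^ L := by
  have h : (2 : ℝ) ^ (ρ₁ * L) ≤ ((2 ^ L : ℕ) : ℝ) := by
    calc (2 : ℝ) ^ (ρ₁ * L) ≤ (2 : ℝ) ^ ((L : ℝ)) :=
          Real.rpow_le_rpow_of_exponent_le (by norm_num)
            (mul_le_of_le_one_left (Nat.cast_nonneg L) hρ)
      _ = ((2 ^ L : ℕ) : ℝ) := by rw [Real.rpow_natCast]; push_cast; rfl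
  exact Nat.floor_le_of_le h

theorem le_node (L i₁ i₂ i₃ : ℕ) : L ≤ node L i₁ i₂ i₃ := by
  have h1 : 3 * 2 ^ L + i₁ - 1 ≤ kthPrime (3 * 2 ^ L + i₁) :=
    (Nat.nth_strictMono Nat.infinite_setOfPred_prime).id_le _
  have h2 : L < 2 ^ L := Nat.lt_two_pow_self
  have h3 := (kthPrime_prime (4 * 2 ^ L + i₂)).pos
  have h4 := (kthPrime_prime (5 * 2 ^ L + i₃)).pos
  calc L ≤ kthPrime (3 * 2 ^ L + i₁) := by omega
    _ ≤ _ := Nat.le_mul_of_pos_right _ h3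
    _ ≤ _ := Nat.le_mul_of_pos_right _ h4

theorem node_lt {L L' i₁ i₂ i₃ j₁ j₂ j₃ : ℕ} (hL : L < L')
    (h1 : i₁ < 2 ^ L) (h2 : i₂ < 2 ^ L) (h3 : i₃ < 2 ^ L) :
    node L i₁ i₂ i₃ < node L' j₁ j₂ j₃ := by
  have hp : 2 ^ (L + 1) ≤ 2 ^ L' := Nat.pow_le_pow_right (by norm_num) hL
  rw [pow_succ] at hp
  have h0 : 1 ≤ 2 ^ L := Nat.one_le_two_pow
  have a1 : kthPrime (3 * 2 ^ L + i₁) < kthPrime (3 * 2 ^ L' + j₁) :=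
    kthPrime_lt (by omega) (by omega)
  have a2 : kthPrime (4 * 2 ^ L + i₂) < kthPrime (4 * 2 ^ L' + j₂) :=
    kthPrime_lt (by omega) (by omega)
  have a3 : kthPrime (5 * 2 ^ L + i₃) < kthPrime (5 * 2 ^ L' + j₃) :=
    kthPrime_lt (by omega) (by omega)
  exact Nat.mul_lt_mul'' (Nat.mul_lt_mul'' a1 a2) a3

theorem node_inj {L L' i₁ i₂ i₃ j₁ j₂ j₃ : ℕ}
    (hi₁ : i₁ < 2 ^ L) (hi₂ : i₂ < 2 ^ L) (hi₃ : i₃ < 2 ^ L)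
    (hj₁ : j₁ < 2 ^ L') (hj₂ : j₂ < 2 ^ L') (hj₃ : j₃ < 2 ^ L')
    (h : node L i₁ i₂ i₃ = node L' j₁ j₂ j₃) :
    L = L' ∧ i₁ = j₁ ∧ i₂ = j₂ ∧ i₃ = j₃ := by
  have hL : L = L' := by
    rcases lt_trichotomy L L' with h1 | h1 | h1
    · exact absurd h (node_lt h1 hi₁ hi₂ hi₃).ne
    · exact h1
    · exact absurd h (node_lt h1 hj₁ hj₂ hj₃).ne'
  subst hL
  have h0 : 1 ≤ 2 ^ L := Nat.one_le_two_pow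
  have key : ∀ k, 1 ≤ k → kthPrime k ∣ node L j₁ j₂ j₃ →
      k = 3 * 2 ^ L + j₁ ∨ k = 4 * 2 ^ L + j₂ ∨ k = 5 * 2 ^ L + j₃ := by
    intro k hk hd
    have hpk := kthPrime_prime k
    have e : ∀ l, 1 ≤ l → kthPrime k ∣ kthPrime l → k = l := fun l hl hdl =>
      kthPrime_inj hk hl ((Nat.prime_dvd_prime_iff_eq hpk (kthPrime_prime l)).1 hdl)
    rcases (Nat.Prime.dvd_mul hpk).1 hd with hd | hd
    · rcases (Nat.Prime.dvd_mul hpk).1 hd with hd | hd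
      · exact Or.inl (e _ (by omega) hd)
      · exact Or.inr (Or.inl (e _ (by omega) hd))
    · exact Or.inr (Or.inr (e _ (by omega) hd))
  have k1 := key (3 * 2 ^ L + i₁) (by omega)
    (h ▸ Dvd.intro _ (mul_assoc _ _ _).symm)
  have k2 := key (4 * 2 ^ L + i₂) (by omega)
    (h ▸ Dvd.dvd.mul_right (Dvd.intro_left _ rfl) _)
  have k3 := key (5 * 2 ^ L + i₃) (by omega) (h ▸ Dvd.intro_left _ rfl)
  refine ⟨rfl, ?_, ?_, ?_⟩ <;> omega

/-- The value of the coefficient at an `n` of the form `node L i₁ i₂ i₃`. -/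
theorem coeff_node {ρ₁ : ℝ} (hρ : ρ₁ ≤ 1) (β : ℕ → ℂ) {L i₁ i₂ i₃ : ℕ} (hL : 1 ≤ L)
    (h1 : i₁ < firstSize ρ₁ L) (h2 : i₂ < 2 ^ L) (h3 : i₃ < 2 ^ L) :
    coeff ρ₁ β (node L i₁ i₂ i₃) = nodeCoeff ρ₁ β L i₁ i₂ i₃ := by
  have hlt : ∀ {K i : ℕ}, i < firstSize ρ₁ K → i < 2 ^ K :=
    fun h => lt_of_lt_of_le h (firstSize_le hρ _)
  unfold coeff
  rw [Finset.sum_eq_single L, Finset.sum_eq_single i₁, Finset.sum_eq_single i₂,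
    Finset.sum_eq_single i₃, if_pos rfl]
  · intro j hj hne
    rw [if_neg]
    intro he
    exact hne (node_inj (hlt h1) h2 h3 (hlt h1) h2 (Finset.mem_range.1 hj) he).2.2.2.symm
  · intro h; exact absurd (Finset.mem_range.2 h3) h
  · intro j hj hne
    refine Finset.sum_eq_zero fun k hk => if_neg fun he => ?_
    exact hne (node_inj (hlt h1) h2 h3 (hlt h1) (Finset.mem_range.1 hj)
      (Finset.mem_range.1 hk) he).2.2.1.symm
  · intro h; exact absurd (Finset.mem_range.2 h2) h
  · intro j hj hne
    refine Finset.sum_eq_zero fun k hk => Finset.sum_eq_zero fun l hl => if_neg fun he => ?_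
    exact hne (node_inj (hlt h1) h2 h3 (hlt (Finset.mem_range.1 hj)) (Finset.mem_range.1 hk)
      (Finset.mem_range.1 hl) he).2.1.symm
  · intro h; exact absurd (Finset.mem_range.2 h1) h
  · intro K _ hne
    refine Finset.sum_eq_zero fun j hj => Finset.sum_eq_zero fun k hk =>
      Finset.sum_eq_zero fun l hl => if_neg fun he => ?_
    exact hne (node_inj (hlt h1) h2 h3 (hlt (Finset.mem_range.1 hj)) (Finset.mem_range.1 hk)
      (Finset.mem_range.1 hl) he).1.symm
  · intro h; exact absurd (Finset.mem_Icc.2 ⟨hL, le_node L i₁ i₂ i₃⟩) h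

/-- The coefficient vanishes at every other `n`. -/
theorem coeff_eq_zero {ρ₁ : ℝ} (β : ℕ → ℂ) {n : ℕ}
    (h : ∀ L i₁ i₂ i₃ : ℕ, 1 ≤ L → i₁ < firstSize ρ₁ L → i₂ < 2 ^ L → i₃ < 2 ^ L →
      n ≠ node L i₁ i₂ i₃) :
    coeff ρ₁ β n = 0 :=
  Finset.sum_eq_zero fun L hL => Finset.sum_eq_zero fun i hi => Finset.sum_eq_zero fun j hj =>
    Finset.sum_eq_zero fun k hk => if_neg
      (h L i j k (Finset.mem_Icc.1 hL).1 (Finset.mem_range.1 hi) (Finset.mem_range.1 hj)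
        (Finset.mem_range.1 hk))

end BohrStrip

/-! Write N = 2^L, r = r₁ ≈ N^ρ₁, X = 2(ρ₁ + 2)/3. Level L of the series consists of r N² terms of
modulus N^(-X) at integers of size about N³ (up to logarithms), and its phases are those of the
trilinear form ∑ ω^(i₁i₂) ω^(i₂i₃) x y z. Each abscissa compares N^(X + 3σ) with a different measure
of this form.

Absolute values: the sum of moduli is N^(ρ₁ + 2), whence σ_a ≥ (ρ₁ + 2)/9 (`le_of_lseriesSummable`).
Supremum: summing over i₂ last turns the form into ∑ y_j X_j Z_j with discrete Fourier transforms X,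
Z, so Cauchy–Schwarz and Parseval bound it by N √(N r) (`norm_trilinear_le`), whence σ_b ≤ (1 -
ρ₁)/18. Partial sums: a cutoff n ≤ M is a cutoff in i₃ for each fixed i₁, i₂. The incomplete
geometric sums in i₃ total O(N log N) over i₂, which gives r N log N uniformly in M
(`norm_levelPartial_le`), whence σ_c ≤ (ρ₁ - 1)/9.

For σ_b ≥ 0, the supremum bound is sharp up to a logarithm: quadratic phases for x and z have nearly
flat Fourier transforms (`exists_le_norm_trilinear`). Logarithms of distinct primes are linearly
independent over the rationals, so averaging against a Riesz product carries the polydisc bound to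
the imaginary axis at the cost of a factor 8 (`norm_sum_prod_le_of_forall_norm_le`). Hence the level
sums are unbounded on Re s = 0 as L grows, like N^((1 - ρ₁)/6) up to logarithms. A Baire category
argument on signs β_L = ±1 prevents cancellation between levels (`exists_not_bounded`). The sum on
Re s = 0 makes sense because σ_c < 0. -/

namespace BohrStrip

/-! ### Roots of unity, geometric sums and quadratic exponential sums -/

theorem norm_rootOfUnity (n : ℕ) : ‖rootOfUnity n‖ = 1 := by
  have : rootOfUnity n = Complex.exp (((2 * Real.pi / n : ℝ) : ℂ) * Complex.I) := by
    unfold rootOfUnity; congr 1; push_cast; ring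
  rw [this, Complex.norm_exp_ofReal_mul_I]

theorem isPrimitiveRoot_rootOfUnity {n : ℕ} (hn : n ≠ 0) : IsPrimitiveRoot (rootOfUnity n) n :=
  Complex.isPrimitiveRoot_exp n hn

theorem norm_one_sub_rootOfUnity_pow (n h : ℕ) :
    ‖1 - rootOfUnity n ^ h‖ = |2 * Real.sin (Real.pi * h / n)| := by
  have : rootOfUnity n ^ h = Complex.exp (Complex.I * ((2 * (Real.pi * h / n) : ℝ) : ℂ)) := by
    unfold rootOfUnity; rw [← Complex.exp_nat_mul]; congr 1; push_cast; ring
  rw [this, norm_sub_rev, Complex.norm_exp_I_mul_ofReal_sub_one, Real.norm_eq_abs]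
  congr 3; ring

/-- Jordan's inequality for the sine, applied to whichever of h and n - h is at most n/2. Adding
both reciprocals avoids a minimum, and each contributes a harmonic sum. -/
theorem inv_norm_one_sub_rootOfUnity_pow_le {n h : ℕ} (h0 : 0 < h) (hn : h < n) :
    ‖1 - rootOfUnity n ^ h‖⁻¹ ≤ n / 4 * ((h : ℝ)⁻¹ + ((n - h : ℕ) : ℝ)⁻¹) := by
  have key : ∀ k : ℕ, 0 < k → 2 * k ≤ n → (Real.sin (Real.pi * k / n))⁻¹ ≤ n / 2 * (k : ℝ)⁻¹ := by
    intro k hk hkn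
    have hkR : (0 : ℝ) < k := by exact_mod_cast hk
    have hnR : (0 : ℝ) < n := by exact_mod_cast (show 0 < n by omega)
    have hkn' : 2 * (k : ℝ) ≤ n := by exact_mod_cast hkn
    have hs := Real.mul_le_sin (x := Real.pi * k / n) (by positivity) (by
      rw [div_le_div_iff₀ hnR two_pos]; nlinarith [Real.pi_pos])
    have e : 2 / Real.pi * (Real.pi * k / n) = 2 * k / n := by
      field_simp
    rw [e] at hs
    calc _ ≤ (2 * (k : ℝ) / n)⁻¹ := inv_anti₀ (by positivity) hs
      _ = _ := by field_simp
  have hpos : 0 < Real.sin (Real.pi * h / n) := by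
    have hnR : (0 : ℝ) < n := by exact_mod_cast (show 0 < n by omega)
    have hhR : (0 : ℝ) < h := by exact_mod_cast h0
    have hlt : (h : ℝ) < n := by exact_mod_cast hn
    apply Real.sin_pos_of_pos_of_lt_pi (by positivity)
    rw [div_lt_iff₀ hnR]; nlinarith [Real.pi_pos]
  rw [norm_one_sub_rootOfUnity_pow, abs_of_pos (by positivity), mul_inv]
  have p1 : (0 : ℝ) ≤ (h : ℝ)⁻¹ := by positivity
  have p2 : (0 : ℝ) ≤ ((n - h : ℕ) : ℝ)⁻¹ := by positivity
  have p3 : (0 : ℝ) ≤ n := by positivity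
  rcases le_total (2 * h) n with h2 | h2
  · have := key h h0 h2
    nlinarith [mul_nonneg p3 p2]
  · have := key (n - h) (by omega) (by omega)
    have e : Real.sin (Real.pi * ((n - h : ℕ) : ℝ) / n) = Real.sin (Real.pi * h / n) := by
      rw [← Real.sin_pi_sub (Real.pi * h / n)]
      congr 1
      have hnR : (n : ℝ) ≠ 0 := by exact_mod_cast (show n ≠ 0 by omega)
      rw [Nat.cast_sub hn.le]; field_simp
    rw [e] at this
    nlinarith [mul_nonneg p3 p1]

theorem sum_inv_norm_one_sub_rootOfUnity_pow_le (n : ℕ) :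
    ∑ h ∈ Finset.Ico 1 n, ‖1 - rootOfUnity n ^ h‖⁻¹ ≤ n / 2 * (1 + Real.log n) := by
  rcases Nat.eq_zero_or_pos n with rfl | hn
  · simp
  have hH : ∑ h ∈ Finset.Ico 1 n, (h : ℝ)⁻¹ ≤ 1 + Real.log n := by
    have h1 := harmonic_le_one_add_log n
    rw [harmonic_eq_sum_Icc] at h1
    push_cast at h1
    refine le_trans (Finset.sum_le_sum_of_subset_of_nonneg ?_ fun i _ _ => by positivity) h1
    intro i; simp only [Finset.mem_Ico, Finset.mem_Icc]; omega
  have hR : ∑ h ∈ Finset.Ico 1 n, ((n - h : ℕ) : ℝ)⁻¹ = ∑ h ∈ Finset.Ico 1 n, (h : ℝ)⁻¹ := by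
    refine Finset.sum_nbij' (fun h => n - h) (fun h => n - h) ?_ ?_ ?_ ?_ (fun _ _ => rfl) <;>
      · intro i; simp only [Finset.mem_Ico]; omega
  calc _ ≤ ∑ h ∈ Finset.Ico 1 n, (n : ℝ) / 4 * ((h : ℝ)⁻¹ + ((n - h : ℕ) : ℝ)⁻¹) := by
        refine Finset.sum_le_sum fun h hh => ?_
        rw [Finset.mem_Ico] at hh
        exact inv_norm_one_sub_rootOfUnity_pow_le hh.1 hh.2
    _ = n / 4 * (2 * ∑ h ∈ Finset.Ico 1 n, (h : ℝ)⁻¹) := by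
        rw [← Finset.mul_sum, Finset.sum_add_distrib, hR]; ring
    _ ≤ n / 4 * (2 * (1 + Real.log n)) := by gcongr
    _ = _ := by ring

theorem norm_geom_sum_le {ζ : ℂ} (hζ : ‖ζ‖ = 1) (h1 : ζ ≠ 1) (m : ℕ) :
    ‖∑ k ∈ Finset.range m, ζ ^ k‖ ≤ 2 * ‖1 - ζ‖⁻¹ := by
  rw [geom_sum_eq h1, norm_div, norm_sub_rev ζ 1, div_eq_mul_inv]
  gcongr
  calc ‖ζ ^ m - 1‖ ≤ ‖ζ ^ m‖ + ‖(1 : ℂ)‖ := norm_sub_le _ _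
    _ = 2 := by rw [norm_pow, hζ]; norm_num

/-- Van der Corput's inequality without averaging. -/
theorem norm_sum_sq_le_sum_correlation (u : ℕ → ℂ) (r : ℕ) :
    ‖∑ i ∈ Finset.range r, u i‖ ^ 2 ≤ 2 * ∑ h ∈ Finset.range r,
      ‖∑ k ∈ Finset.range (r - h), u (h + k) * (starRingEnd ℂ) (u k)‖ -
        ∑ i ∈ Finset.range r, ‖u i‖ ^ 2 := by
  -- The double sum is grouped by the larger index m, so that passing from r to r + 1 adds one row.
  -- `Finset.sum_range_diag_flip` later regroups it by the difference h. Doubling counts the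
  -- diagonal twice, hence the subtracted term.
  have key : ∀ r : ℕ, ‖∑ i ∈ Finset.range r, u i‖ ^ 2 = 2 * (∑ m ∈ Finset.range r,
      ∑ k ∈ Finset.range (m + 1), u (k + (m - k)) * (starRingEnd ℂ) (u (m - k))).re -
        ∑ i ∈ Finset.range r, ‖u i‖ ^ 2 := by
    intro r
    induction r with
    | zero => simp
    | succ r ih =>
      have e : ∑ k ∈ Finset.range (r + 1), u (k + (r - k)) * (starRingEnd ℂ) (u (r - k)) =
          u r * (starRingEnd ℂ) (∑ i ∈ Finset.range r, u i) + u r * (starRingEnd ℂ) (u r) := by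
        rw [map_sum, Finset.mul_sum, ← Finset.sum_range_succ (fun i => u r * (starRingEnd ℂ) (u i)),
          ← Finset.sum_range_reflect]
        refine Finset.sum_congr rfl fun k hk => ?_
        rw [Finset.mem_range] at hk
        rw [show r + 1 - 1 - k + (r - (r + 1 - 1 - k)) = r by omega,
          show r - (r + 1 - 1 - k) = k by omega]
      rw [Finset.sum_range_succ u, Finset.sum_range_succ (fun i => ‖u i‖ ^ 2),
        Finset.sum_range_succ (fun m => ∑ k ∈ Finset.range (m + 1),
          u (k + (m - k)) * (starRingEnd ℂ) (u (m - k))), e,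
        Complex.add_re, Complex.add_re, Complex.mul_conj, Complex.ofReal_re,
        Complex.normSq_eq_norm_sq, ← Complex.normSq_eq_norm_sq (_ + _), add_comm _ (u r),
        Complex.normSq_add, Complex.normSq_eq_norm_sq, Complex.normSq_eq_norm_sq, ih]
      ring
  rw [key, Finset.sum_range_diag_flip r (fun h k => u (h + k) * (starRingEnd ℂ) (u k))]
  gcongr
  exact (Complex.re_le_norm _).trans (norm_sum_le _ _)

/-- In the correlation at shift h the squares and the linear phase η cancel, leaving a geometric sum
with ratio exp(2πi h/r). This is why the root has order 2r. The shift h = 0 gives r, the others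
together at most r(1 + log r). -/
theorem norm_quadratic_sum_sq_le (r : ℕ) {η : ℂ} (hη : ‖η‖ = 1) :
    ‖∑ i ∈ Finset.range r, rootOfUnity (2 * r) ^ (i ^ 2) * η ^ i‖ ^ 2 ≤
      r * (3 + 2 * Real.log r) := by
  rcases Nat.eq_zero_or_pos r with rfl | hr
  · simp
  set w := rootOfUnity (2 * r) with hw
  have hw1 : ‖w‖ = 1 := norm_rootOfUnity _
  have hw2 : w ^ 2 = rootOfUnity r := by
    rw [hw]; unfold rootOfUnity
    rw [← Complex.exp_nat_mul]; congr 1; push_cast; field_simp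
  refine (norm_sum_sq_le_sum_correlation _ r).trans ?_
  have hcorr : ∀ h : ℕ, ‖∑ k ∈ Finset.range (r - h), w ^ ((h + k) ^ 2) * η ^ (h + k) *
      (starRingEnd ℂ) (w ^ (k ^ 2) * η ^ k)‖ =
      ‖∑ k ∈ Finset.range (r - h), (rootOfUnity r ^ h) ^ k‖ := by
    intro h
    have : ∀ k : ℕ, w ^ ((h + k) ^ 2) * η ^ (h + k) * (starRingEnd ℂ) (w ^ (k ^ 2) * η ^ k) =
        (w ^ (h ^ 2) * η ^ h) * (rootOfUnity r ^ h) ^ k := by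
      intro k
      have c1 : w ^ (k ^ 2) * (starRingEnd ℂ) (w ^ (k ^ 2)) = 1 := by
        rw [Complex.mul_conj, Complex.normSq_eq_norm_sq, norm_pow, hw1]; simp
      have c2 : η ^ k * (starRingEnd ℂ) (η ^ k) = 1 := by
        rw [Complex.mul_conj, Complex.normSq_eq_norm_sq, norm_pow, hη]; simp
      rw [map_mul, ← hw2]
      calc _ = w ^ (h ^ 2) * η ^ h * ((w ^ 2) ^ h) ^ k *
            (w ^ (k ^ 2) * (starRingEnd ℂ) (w ^ (k ^ 2))) *
            (η ^ k * (starRingEnd ℂ) (η ^ k)) := by ring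
        _ = _ := by rw [c1, c2, mul_one, mul_one]
    rw [Finset.sum_congr rfl fun k _ => this k, ← Finset.mul_sum, norm_mul, norm_mul, norm_pow,
      norm_pow, hw1, hη]
    simp
  simp only [hcorr]
  have h1 : ∑ i ∈ Finset.range r, ‖w ^ (i ^ 2) * η ^ i‖ ^ 2 = r := by
    simp [hw1, hη]
  rw [h1, Finset.range_eq_Ico, Finset.sum_eq_sum_Ico_succ_bot hr]
  have h2 : ∑ h ∈ Finset.Ico (0 + 1) r, ‖∑ k ∈ Finset.range (r - h), (rootOfUnity r ^ h) ^ k‖ ≤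
      r * (1 + Real.log r) := by
    calc _ ≤ ∑ h ∈ Finset.Ico 1 r, 2 * ‖1 - rootOfUnity r ^ h‖⁻¹ := by
          refine Finset.sum_le_sum fun h hh => norm_geom_sum_le ?_ ?_ _
          · rw [norm_pow, norm_rootOfUnity, one_pow]
          · rw [Finset.mem_Ico] at hh
            exact (isPrimitiveRoot_rootOfUnity hr.ne').pow_ne_one_of_pos_of_lt (by omega) hh.2
      _ ≤ _ := by
          rw [← Finset.mul_sum]
          linarith [sum_inv_norm_one_sub_rootOfUnity_pow_le r]
  have h3 : ‖∑ k ∈ Finset.Ico 0 (r - 0), (rootOfUnity r ^ 0) ^ k‖ = r := by simp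
  simp only [← Finset.range_eq_Ico] at h3 ⊢
  rw [h3]
  linarith

theorem sum_range_add_eq_of_periodic {f : ℕ → ℂ} {N : ℕ} (hf : ∀ k, f (k + N) = f k) (h : ℕ) :
    ∑ k ∈ Finset.range N, f (h + k) = ∑ k ∈ Finset.range N, f k := by
  induction h with
  | zero => simp
  | succ h ih =>
    rw [← ih]
    have h1 := Finset.sum_range_succ (fun k => f (h + k)) N
    have h2 := Finset.sum_range_succ' (fun k => f (h + k)) N
    simp only [hf, add_zero] at h1 h2
    rw [h1] at h2
    have := add_right_cancel h2
    rw [this]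
    exact Finset.sum_congr rfl fun k _ => by congr 1; ring

theorem sum_rootOfUnity_pow_mul (N h : ℕ) (h0 : 0 < h) (hN : h < N) :
    ∑ k ∈ Finset.range N, (rootOfUnity N ^ h) ^ k = 0 := by
  have hp := isPrimitiveRoot_rootOfUnity (n := N) (by omega)
  rw [geom_sum_eq (hp.pow_ne_one_of_pos_of_lt (by omega) hN), ← pow_mul, mul_comm, pow_mul,
    hp.pow_eq_one]
  simp

/-- The modulus of the quadratic Gauss sum. -/
theorem norm_gauss_sum_sq {N : ℕ} (hN : Even N) (hN0 : 0 < N) (j : ℕ) :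
    ‖∑ k ∈ Finset.range N, rootOfUnity (2 * N) ^ (k ^ 2) * rootOfUnity N ^ (j * k)‖ ^ 2 = N := by
  set w := rootOfUnity (2 * N) with hw
  have hw1 : ‖w‖ = 1 := norm_rootOfUnity _
  have hw2 : w ^ 2 = rootOfUnity N := by
    rw [hw]; unfold rootOfUnity
    rw [← Complex.exp_nat_mul]; congr 1; push_cast; field_simp
  have hwN : w ^ (2 * N) = 1 := (isPrimitiveRoot_rootOfUnity (n := 2 * N) (by omega)).pow_eq_one
  set u : ℕ → ℂ := fun k => w ^ (k ^ 2) * rootOfUnity N ^ (j * k) with hu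
  have hu' : ∀ k, u k = w ^ (k ^ 2 + 2 * (j * k)) := fun k => by
    simp only [hu, ← hw2, ← pow_mul, ← pow_add]
  have hu1 : ∀ k, ‖u k‖ = 1 := fun k => by rw [hu', norm_pow, hw1, one_pow]
  -- Evenness of N enters here: (k + N)² - k² = 2N(k + N/2) is then a multiple of 2N.
  have hper : ∀ k, u (k + N) = u k := by
    intro k
    obtain ⟨M, hM⟩ := hN
    rw [hu', hu', show (k + N) ^ 2 + 2 * (j * (k + N)) =
      k ^ 2 + 2 * (j * k) + 2 * N * (k + M + j) by
        rw [hM]; ring, pow_add, pow_mul w (2 * N), hwN, one_pow, mul_one]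
  have hmul : ∀ h k, u (h + k) * (starRingEnd ℂ) (u k) = u h * (rootOfUnity N ^ h) ^ k := by
    intro h k
    have c : u k * (starRingEnd ℂ) (u k) = 1 := by
      rw [Complex.mul_conj, Complex.normSq_eq_norm_sq, hu1]; simp
    have : u (h + k) = u h * (rootOfUnity N ^ h) ^ k * u k := by
      rw [hu', hu', hu', ← hw2]; ring
    rw [this, mul_assoc, c, mul_one]
  have e : ((‖∑ k ∈ Finset.range N, u k‖ ^ 2 : ℝ) : ℂ) = N := by
    rw [← Complex.normSq_eq_norm_sq, ← Complex.mul_conj, map_sum, Finset.mul_sum]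
    calc _ = ∑ k ∈ Finset.range N, ∑ h ∈ Finset.range N, u (h + k) * (starRingEnd ℂ) (u k) := by
          refine Finset.sum_congr rfl fun k _ => ?_
          rw [← sum_range_add_eq_of_periodic hper k, Finset.sum_mul]
          simp only [add_comm]
      _ = ∑ h ∈ Finset.range N, u h * ∑ k ∈ Finset.range N, (rootOfUnity N ^ h) ^ k := by
          rw [Finset.sum_comm]
          simp only [hmul, Finset.mul_sum]
      _ = u 0 * ∑ k ∈ Finset.range N, (rootOfUnity N ^ 0) ^ k := by
          refine Finset.sum_eq_single 0 (fun h hh h0 => ?_) (by simp [hN0])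
          rw [sum_rootOfUnity_pow_mul N h (by omega) (Finset.mem_range.1 hh), mul_zero]
      _ = N := by simp [hu]
  exact_mod_cast e

/-! ### The trilinear form: upper and lower bounds -/

/-- Orthogonality of the characters modulo N; r ≤ N keeps the frequencies i distinct modulo N. -/
theorem parseval_rootOfUnity {N r : ℕ} (hr : r ≤ N) (x : ℕ → ℂ) :
    ∑ j ∈ Finset.range N, ‖∑ i ∈ Finset.range r, x i * rootOfUnity N ^ (i * j)‖ ^ 2 =
      N * ∑ i ∈ Finset.range r, ‖x i‖ ^ 2 := by
  set ω := rootOfUnity N with hω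
  have orth : ∀ i ∈ Finset.range r, ∀ k ∈ Finset.range r,
      ∑ j ∈ Finset.range N, ω ^ (i * j) * (starRingEnd ℂ) (ω ^ (k * j)) =
        if k = i then (N : ℂ) else 0 := by
    have c : ω * (starRingEnd ℂ) ω = 1 := by
      rw [Complex.mul_conj, Complex.normSq_eq_norm_sq, norm_rootOfUnity]; simp
    have c' : (starRingEnd ℂ) ω * ω = 1 := by rw [mul_comm, c]
    intro i hi k hk
    rw [Finset.mem_range] at hi hk
    rcases lt_trichotomy i k with h | h | h
    · rw [if_neg h.ne']
      have h3 := congrArg (starRingEnd ℂ) (sum_rootOfUnity_pow_mul N (k - i) (by omega) (by omega))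
      rw [map_sum, map_zero] at h3
      rw [← h3]
      refine Finset.sum_congr rfl fun j _ => ?_
      obtain ⟨d, rfl⟩ := Nat.exists_eq_add_of_lt h
      rw [show i + d + 1 - i = d + 1 by omega]
      simp only [map_pow, ← hω]
      rw [show (i + d + 1) * j = i * j + (d + 1) * j by ring, pow_add, ← mul_assoc, ← mul_pow, c,
        one_pow, one_mul, pow_mul]
    · subst h
      simp only [map_pow, ← mul_pow, c]
      simp
    · rw [if_neg h.ne]
      rw [← sum_rootOfUnity_pow_mul N (i - k) (by omega) (by omega)]
      refine Finset.sum_congr rfl fun j _ => ?_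
      obtain ⟨d, rfl⟩ := Nat.exists_eq_add_of_lt h
      rw [show k + d + 1 - k = d + 1 by omega]
      simp only [map_pow, ← hω]
      rw [show (k + d + 1) * j = (d + 1) * j + k * j by ring, pow_add, mul_assoc, ← mul_pow, c,
        one_pow, mul_one, pow_mul]
  have e : ((∑ j ∈ Finset.range N, ‖∑ i ∈ Finset.range r, x i * ω ^ (i * j)‖ ^ 2 : ℝ) : ℂ) =
      ((N * ∑ i ∈ Finset.range r, ‖x i‖ ^ 2 : ℝ) : ℂ) := by
    push_cast
    simp only [← Complex.ofReal_pow]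
    simp only [← Complex.normSq_eq_norm_sq, ← Complex.mul_conj, map_sum, Finset.sum_mul_sum]
    rw [Finset.sum_comm, Finset.mul_sum]
    refine Finset.sum_congr rfl fun i hi => ?_
    rw [Finset.sum_comm]
    calc _ = ∑ k ∈ Finset.range r, x i * (starRingEnd ℂ) (x k) *
          ∑ j ∈ Finset.range N, ω ^ (i * j) * (starRingEnd ℂ) (ω ^ (k * j)) := by
          refine Finset.sum_congr rfl fun k _ => ?_
          rw [Finset.mul_sum]
          refine Finset.sum_congr rfl fun j _ => ?_
          rw [map_mul]; ring
      _ = ∑ k ∈ Finset.range r, x i * (starRingEnd ℂ) (x k) * if k = i then (N : ℂ) else 0 :=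
          Finset.sum_congr rfl fun k hk => by rw [orth i hi k hk]
      _ = _ := by
          rw [Finset.sum_eq_single i (fun k _ hk => by rw [if_neg hk, mul_zero])
            (fun h => absurd hi h), if_pos rfl]
          ring
  exact_mod_cast e

/-- With j = i₂ fixed, the sums over i₁ and i₃ separate into Fourier transforms X j and Z j. The
factor y j is bounded by ν, and Cauchy–Schwarz with Parseval handles the rest. -/
theorem norm_trilinear_le {N r : ℕ} (hr : r ≤ N) {x y z : ℕ → ℂ} {ν : ℝ}
    (hx : ∀ i < r, ‖x i‖ ≤ ν) (hy : ∀ i < N, ‖y i‖ ≤ ν) (hz : ∀ i < N, ‖z i‖ ≤ ν) (hν : 0 ≤ ν) :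
    ‖∑ i₁ ∈ Finset.range r, ∑ i₂ ∈ Finset.range N, ∑ i₃ ∈ Finset.range N,
      rootOfUnity N ^ (i₁ * i₂) * rootOfUnity N ^ (i₂ * i₃) * (x i₁ * y i₂ * z i₃)‖ ≤
      ν ^ 3 * (N * √(N * r)) := by
  set X : ℕ → ℂ := fun j => ∑ i ∈ Finset.range r, x i * rootOfUnity N ^ (i * j) with hX
  set Z : ℕ → ℂ := fun j => ∑ i ∈ Finset.range N, z i * rootOfUnity N ^ (i * j) with hZ
  have e : ∑ i₁ ∈ Finset.range r, ∑ i₂ ∈ Finset.range N, ∑ i₃ ∈ Finset.range N,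
      rootOfUnity N ^ (i₁ * i₂) * rootOfUnity N ^ (i₂ * i₃) * (x i₁ * y i₂ * z i₃) =
      ∑ j ∈ Finset.range N, y j * (X j * Z j) := by
    rw [Finset.sum_comm]
    refine Finset.sum_congr rfl fun j _ => ?_
    simp only [hX, hZ]
    rw [Finset.sum_mul_sum, Finset.mul_sum]
    simp only [Finset.mul_sum]
    refine Finset.sum_congr rfl fun i _ => Finset.sum_congr rfl fun k _ => ?_
    rw [mul_comm j k]; ring
  have hX2 : ∑ j ∈ Finset.range N, ‖X j‖ ^ 2 ≤ N * (r * ν ^ 2) := by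
    rw [hX, parseval_rootOfUnity hr]
    gcongr
    calc _ ≤ ∑ i ∈ Finset.range r, ν ^ 2 := Finset.sum_le_sum fun i hi => by
          gcongr; exact hx i (Finset.mem_range.1 hi)
      _ = _ := by simp
  have hZ2 : ∑ j ∈ Finset.range N, ‖Z j‖ ^ 2 ≤ N * (N * ν ^ 2) := by
    rw [hZ, parseval_rootOfUnity le_rfl]
    gcongr
    calc _ ≤ ∑ i ∈ Finset.range N, ν ^ 2 := Finset.sum_le_sum fun i hi => by
          gcongr; exact hz i (Finset.mem_range.1 hi)
      _ = _ := by simp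
  rw [e]
  calc _ ≤ ∑ j ∈ Finset.range N, ν * (‖X j‖ * ‖Z j‖) := by
        refine norm_sum_le_of_le _ fun j hj => ?_
        rw [norm_mul, norm_mul]
        gcongr
        exact hy j (Finset.mem_range.1 hj)
    _ = ν * ∑ j ∈ Finset.range N, ‖X j‖ * ‖Z j‖ := by rw [Finset.mul_sum]
    _ ≤ ν * (√(∑ j ∈ Finset.range N, ‖X j‖ ^ 2) * √(∑ j ∈ Finset.range N, ‖Z j‖ ^ 2)) := by
        gcongr
        exact Real.sum_mul_le_sqrt_mul_sqrt _ _ _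
    _ ≤ ν * (√(N * (r * ν ^ 2)) * √(N * (N * ν ^ 2))) := by gcongr
    _ = ν * (√((N * r) * ν ^ 2) * √((N * ν) ^ 2)) := by congr 3 <;> ring_nf
    _ = _ := by
        rw [Real.sqrt_sq (by positivity), Real.sqrt_mul (by positivity), Real.sqrt_sq hν]; ring

/-- Cauchy–Schwarz is nearly sharp when X and Z are nearly flat. Quadratic phases achieve this: the
modulus of Z is exactly √N by the Gauss sum, and that of X exceeds √r by at most a logarithmic
factor. -/
theorem exists_le_norm_trilinear {N r : ℕ} (hN : Even N) (hr0 : 0 < r) (hr : r ≤ N) :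
    ∃ x y z : ℕ → ℂ, (∀ i, ‖x i‖ ≤ 1) ∧ (∀ i, ‖y i‖ ≤ 1) ∧ (∀ i, ‖z i‖ ≤ 1) ∧
      N * √(N * r) / √(3 + 2 * Real.log r) ≤
      ‖∑ i₁ ∈ Finset.range r, ∑ i₂ ∈ Finset.range N, ∑ i₃ ∈ Finset.range N,
      rootOfUnity N ^ (i₁ * i₂) * rootOfUnity N ^ (i₂ * i₃) * (x i₁ * y i₂ * z i₃)‖ := by
  have hN0 : 0 < N := hr0.trans_le hr
  have hlog : 0 ≤ Real.log r := Real.log_natCast_nonneg r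
  set B : ℝ := √(r * (3 + 2 * Real.log r)) with hB
  have hB0 : 0 < B := Real.sqrt_pos.2 (by positivity)
  have hN1 : 0 < √(N : ℝ) := Real.sqrt_pos.2 (by positivity)
  set x : ℕ → ℂ := fun i => rootOfUnity (2 * r) ^ (i ^ 2) with hx
  set z : ℕ → ℂ := fun i => rootOfUnity (2 * N) ^ (i ^ 2) with hz
  set X : ℕ → ℂ := fun j => ∑ i ∈ Finset.range r, x i * rootOfUnity N ^ (i * j) with hX
  set Z : ℕ → ℂ := fun j => ∑ i ∈ Finset.range N, z i * rootOfUnity N ^ (j * i) with hZ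
  have hx1 : ∀ i, ‖x i‖ = 1 := fun i => by rw [hx, norm_pow, norm_rootOfUnity, one_pow]
  have hz1 : ∀ i, ‖z i‖ = 1 := fun i => by rw [hz, norm_pow, norm_rootOfUnity, one_pow]
  have hZj : ∀ j, ‖Z j‖ = √N := fun j => by
    rw [← norm_gauss_sum_sq hN hN0 j, Real.sqrt_sq (norm_nonneg _)]
  have hXj : ∀ j, ‖X j‖ ≤ B := fun j => by
    refine Real.le_sqrt_of_sq_le ?_
    have := norm_quadratic_sum_sq_le r (η := rootOfUnity N ^ j) (by
      rw [norm_pow, norm_rootOfUnity, one_pow])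
    simpa only [← pow_mul, mul_comm j] using this
  -- The conjugate aligns all terms. Dividing by the uniform bound B √N, rather than by the modulus
  -- of X j * Z j, leaves squares of the moduli of X, which Parseval sums exactly.
  refine ⟨x, fun j => (starRingEnd ℂ) (X j * Z j) / ((B * √N : ℝ) : ℂ), z,
    fun i => (hx1 i).le, fun j => ?_, fun i => (hz1 i).le, ?_⟩
  · rw [norm_div, RCLike.norm_conj, norm_mul, hZj, Complex.norm_real, Real.norm_eq_abs,
      abs_of_pos (by positivity)]
    rw [div_le_one (by positivity)]
    gcongr
    exact hXj j
  · have e : ∑ i₁ ∈ Finset.range r, ∑ i₂ ∈ Finset.range N, ∑ i₃ ∈ Finset.range N,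
        rootOfUnity N ^ (i₁ * i₂) * rootOfUnity N ^ (i₂ * i₃) *
        (x i₁ * ((starRingEnd ℂ) (X i₂ * Z i₂) / ((B * √N : ℝ) : ℂ)) * z i₃) =
        (((N * ∑ i ∈ Finset.range r, ‖x i‖ ^ 2) * N / (B * √N) : ℝ) : ℂ) := by
      rw [Finset.sum_comm, ← parseval_rootOfUnity hr, Finset.sum_mul, Finset.sum_div,
        Complex.ofReal_sum]
      refine Finset.sum_congr rfl fun j _ => ?_
      calc _ = (X j * Z j) * (starRingEnd ℂ) (X j * Z j) / ((B * √N : ℝ) : ℂ) := by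
            simp only [hX, hZ, mul_div_assoc]
            rw [Finset.sum_mul_sum, Finset.sum_mul]
            refine Finset.sum_congr rfl fun i _ => ?_
            rw [Finset.sum_mul]
            refine Finset.sum_congr rfl fun k _ => ?_
            ring
        _ = _ := by
            rw [Complex.mul_conj, Complex.normSq_eq_norm_sq, norm_mul, mul_pow, hZj,
              Real.sq_sqrt (Nat.cast_nonneg _), ← Complex.ofReal_div]
    rw [e, Complex.norm_real, Real.norm_eq_abs, abs_of_nonneg (by positivity)]
    simp only [hx1, one_pow, Finset.sum_const, Finset.card_range, nsmul_eq_mul, mul_one]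
    have hr1 : (0 : ℝ) < r := by exact_mod_cast hr0
    have hL1 : 0 < √(3 + 2 * Real.log r) := Real.sqrt_pos.2 (by positivity)
    rw [hB, Real.sqrt_mul (Nat.cast_nonneg N), Real.sqrt_mul hr1.le,
      div_le_div_iff₀ hL1 (by positivity)]
    apply le_of_eq
    have h1 := Real.mul_self_sqrt hr1.le
    have h2 := Real.mul_self_sqrt (Nat.cast_nonneg (α := ℝ) N)
    linear_combination (↑N * √(3 + 2 * Real.log r) * (√N * √N)) * h1 +
      (N * r * √(3 + 2 * Real.log r)) * h2

/-! ### Mean values and Riesz products -/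

/-- `F` is continuous and `T⁻¹ ∫₀ᵀ F` tends to `m`. -/
def HasMean (F : ℝ → ℂ) (m : ℂ) : Prop :=
  Continuous F ∧ Tendsto (fun T : ℝ => (T : ℂ)⁻¹ * ∫ t in (0 : ℝ)..T, F t) atTop (𝓝 m)

theorem HasMean.const_mul {F : ℝ → ℂ} {m : ℂ} (h : HasMean F m) (c : ℂ) :
    HasMean (fun t => c * F t) (c * m) := by
  refine ⟨continuous_const.mul h.1, ?_⟩
  have := h.2.const_mul c
  refine this.congr fun T => ?_
  rw [intervalIntegral.integral_const_mul]; ring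

theorem HasMean.sum {κ : Type*} {s : Finset κ} {F : κ → ℝ → ℂ} {m : κ → ℂ}
    (h : ∀ k ∈ s, HasMean (F k) (m k)) :
    HasMean (fun t => ∑ k ∈ s, F k t) (∑ k ∈ s, m k) := by
  refine ⟨continuous_finsetSum _ fun k hk => (h k hk).1, ?_⟩
  have := tendsto_finsetSum s fun k hk => (h k hk).2
  refine this.congr fun T => ?_
  rw [intervalIntegral.integral_finsetSum fun k hk => (h k hk).1.intervalIntegrable _ _,
    Finset.mul_sum]

theorem hasMean_exp (l : ℝ) :
    HasMean (fun t => Complex.exp ((Complex.I * l) * t)) (if l = 0 then 1 else 0) := by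
  refine ⟨by fun_prop, ?_⟩
  split_ifs with h
  · subst h
    refine tendsto_const_nhds.congr' ?_
    filter_upwards [eventually_gt_atTop 0] with T hT
    have : (T : ℂ) ≠ 0 := by exact_mod_cast hT.ne'
    simp [this]
  · have hc : Complex.I * (l : ℂ) ≠ 0 := by simp [h]
    have hb : ∀ T : ℝ, ‖∫ t in (0 : ℝ)..T, Complex.exp ((Complex.I * l) * t)‖ ≤ 2 * |l|⁻¹ := by
      intro T
      rw [integral_exp_mul_complex hc, norm_div, norm_mul, Complex.norm_I, one_mul,
        Complex.norm_real, Real.norm_eq_abs, div_eq_mul_inv]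
      gcongr
      refine (norm_sub_le _ _).trans ?_
      have e : ∀ u : ℝ, ‖Complex.exp (Complex.I * l * u)‖ = 1 := fun u => by
        rw [show Complex.I * l * u = ((l * u : ℝ) : ℂ) * Complex.I by push_cast; ring,
          Complex.norm_exp_ofReal_mul_I]
      rw [e, e]; norm_num
    have hz : Tendsto (fun T : ℝ => ‖(T : ℂ)⁻¹‖) atTop (𝓝 0) := by
      refine (tendsto_inv_atTop_zero.comp tendsto_abs_atTop_atTop).congr fun T => ?_
      simp
    have hz' := hz.mul_const (2 * |l|⁻¹)
    rw [zero_mul] at hz'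
    refine squeeze_zero_norm (fun T => ?_) hz'
    rw [norm_mul]
    exact mul_le_mul_of_nonneg_left (hb T) (norm_nonneg _)

/-- Intended for K a Riesz product, which acts as a probability density on the real line. -/
theorem HasMean.norm_le {F : ℝ → ℂ} {K : ℝ → ℝ} {m : ℂ} {C : ℝ} (hF : HasMean F m)
    (hK : HasMean (fun t => (K t : ℂ)) 1) (h : ∀ t, ‖F t‖ ≤ C * K t) : ‖m‖ ≤ C := by
  have hKc : Continuous K := by
    have := Complex.continuous_re.comp hK.1
    exact this.congr fun t => Complex.ofReal_re _
  have h2 : Tendsto (fun T : ℝ => C * (T⁻¹ * ∫ t in (0 : ℝ)..T, K t)) atTop (𝓝 (C * 1)) := by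
    refine Tendsto.const_mul C ?_
    have := (Complex.continuous_re.tendsto _).comp hK.2
    refine this.congr fun T => ?_
    simp only [Function.comp]
    rw [intervalIntegral.integral_ofReal, ← Complex.ofReal_inv, ← Complex.ofReal_mul,
      Complex.ofReal_re]
  rw [mul_one] at h2
  refine le_of_tendsto_of_tendsto hF.2.norm h2 ?_
  filter_upwards [eventually_gt_atTop 0] with T hT
  rw [norm_mul, norm_inv, Complex.norm_real, Real.norm_eq_abs, abs_of_pos hT, mul_left_comm,
    ← intervalIntegral.integral_const_mul]
  gcongr
  exact intervalIntegral.norm_integral_le_of_norm_le hT.le (by filter_upwards with t _ using h t)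
    ((continuous_const.mul hKc).intervalIntegrable _ _)

/-- Unique factorization: moving the negative exponents to the other side and exponentiating gives
an equality of two products of primes. -/
theorem eq_zero_of_sum_mul_log_prime_eq_zero {ι : Type*} [Fintype ι] [DecidableEq ι] {p : ι → ℕ}
    (hp : ∀ i, (p i).Prime) (hinj : Function.Injective p) {m : ι → ℤ}
    (h : ∑ i, (m i : ℝ) * Real.log (p i) = 0) : m = 0 := by
  have hA : ∀ n : ι → ℕ, Real.log ((∏ i, p i ^ n i : ℕ) : ℝ) = ∑ i, (n i : ℝ) * Real.log (p i) := by
    intro n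
    push_cast
    rw [Real.log_prod fun i _ => pow_ne_zero _ (by exact_mod_cast (hp i).ne_zero)]
    simp only [Real.log_pow]
  have hpos : ∀ n : ι → ℕ, 0 < ∏ i, p i ^ n i := fun n =>
    Finset.prod_pos fun i _ => pow_pos (hp i).pos _
  have heq : ∏ i, p i ^ (m i).toNat = ∏ i, p i ^ (-m i).toNat := by
    have : Real.log ((∏ i, p i ^ (m i).toNat : ℕ) : ℝ) =
        Real.log ((∏ i, p i ^ (-m i).toNat : ℕ) : ℝ) := by
      rw [hA, hA, ← sub_eq_zero, ← Finset.sum_sub_distrib, ← h]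
      refine Finset.sum_congr rfl fun i _ => ?_
      rw [← sub_mul]
      congr 1
      exact_mod_cast Int.toNat_sub_toNat_neg (m i)
    exact_mod_cast Real.log_injOn_pos (Set.mem_Ioi.2 (by exact_mod_cast hpos _))
      (Set.mem_Ioi.2 (by exact_mod_cast hpos _)) this
  have hfac : ∀ (n : ι → ℕ) (j : ι), (∏ i, p i ^ n i).factorization (p j) = n j := by
    intro n j
    rw [Nat.factorization_prod fun i _ => pow_ne_zero _ (hp i).ne_zero, Finsupp.finsetSum_apply,
      Finset.sum_eq_single j]
    · rw [(hp j).factorization_pow, Finsupp.single_eq_same]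
    · intro i _ hij
      rw [(hp i).factorization_pow, Finsupp.single_eq_of_ne fun h => hij (hinj h).symm]
    · simp
  funext j
  have := hfac (fun i => (m i).toNat) j
  rw [heq, hfac] at this
  simp only [Pi.zero_apply]
  omega

/-- Coefficients of one factor of a Riesz product: `1 + Re (θ u) = ∑ rieszWeight θ e * u ^ e`. -/
noncomputable def rieszWeight (θ : ℂ) (e : ℤ) : ℂ :=
  if e = 0 then 1 else if e = 1 then θ / 2 else (starRingEnd ℂ) θ / 2

theorem rieszFactor_eq (θ : ℂ) (u : ℝ) :
    ((1 + (θ * Complex.exp (Complex.I * u)).re : ℝ) : ℂ) =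
      ∑ e ∈ ({-1, 0, 1} : Finset ℤ), rieszWeight θ e * Complex.exp (Complex.I * (e * u)) := by
  have hc : (starRingEnd ℂ) (Complex.exp (Complex.I * u)) = Complex.exp (-(Complex.I * u)) := by
    rw [← Complex.exp_conj]; simp
  rw [Finset.sum_insert (by decide), Finset.sum_insert (by decide), Finset.sum_singleton]
  push_cast
  rw [Complex.re_eq_add_conj, map_mul, hc]
  simp [rieszWeight]
  ring

/-- The product expands into exponentials with frequencies ∑ (e i - 1_A(i)) log (p i), e i ∈ {-1, 0,
1}. By independence of the logarithms only e = 1_A has a nonzero mean, and its weight is θ i / 2 for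
each i in A. -/
theorem hasMean_rieszProduct_mul {ι : Type*} [Fintype ι] [DecidableEq ι] {p : ι → ℕ}
    (hp : ∀ i, (p i).Prime) (hinj : Function.Injective p) (θ : ι → ℂ) (A : Finset ι) :
    HasMean (fun t => ((∏ i, (1 + (θ i * Complex.exp (Complex.I * (t * Real.log (p i) : ℝ))).re) :
      ℝ) : ℂ) * ∏ i ∈ A, Complex.exp (-(Complex.I * (t * Real.log (p i) : ℝ))))
      (∏ i ∈ A, (θ i / 2)) := by
  set ind : ι → ℤ := fun i => if i ∈ A then 1 else 0 with hind
  have hF : ∀ t : ℝ, ((∏ i, (1 + (θ i * Complex.exp (Complex.I * (t * Real.log (p i) : ℝ))).re) :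
      ℝ) : ℂ) * ∏ i ∈ A, Complex.exp (-(Complex.I * (t * Real.log (p i) : ℝ))) =
      ∑ e ∈ Fintype.piFinset fun _ : ι => ({-1, 0, 1} : Finset ℤ),
        (∏ i, rieszWeight (θ i) (e i)) * Complex.exp
          ((Complex.I * (∑ i, ((e i - ind i : ℤ) : ℝ) * Real.log (p i) : ℝ)) * t) := by
    intro t
    rw [Complex.ofReal_prod, Finset.prod_congr rfl fun i _ => rieszFactor_eq (θ i) _,
      Finset.prod_univ_sum, Finset.sum_mul]
    refine Finset.sum_congr rfl fun e _ => ?_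
    rw [Finset.prod_mul_distrib, mul_assoc, ← Complex.exp_sum, ← Complex.exp_sum,
      ← Complex.exp_add]
    congr 2
    have : ∑ i ∈ A, -(Complex.I * ((t * Real.log (p i) : ℝ) : ℂ)) =
        ∑ i, -(Complex.I * (ind i * (t * Real.log (p i) : ℝ) : ℂ)) := by
      rw [← Finset.sum_subset (Finset.subset_univ A)]
      · exact Finset.sum_congr rfl fun i hi => by simp [hind, hi]
      · intro i _ hi
        simp [hind, hi]
    rw [this, ← Finset.sum_add_distrib]
    push_cast
    rw [Finset.mul_sum, Finset.sum_mul]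
    refine Finset.sum_congr rfl fun i _ => ?_
    ring
  have hM : HasMean (fun t : ℝ => ∑ e ∈ Fintype.piFinset fun _ : ι => ({-1, 0, 1} : Finset ℤ),
        (∏ i, rieszWeight (θ i) (e i)) * Complex.exp
          ((Complex.I * (∑ i, ((e i - ind i : ℤ) : ℝ) * Real.log (p i) : ℝ)) * t))
      (∑ e ∈ Fintype.piFinset fun _ : ι => ({-1, 0, 1} : Finset ℤ),
        (∏ i, rieszWeight (θ i) (e i)) *
          if ∑ i, ((e i - ind i : ℤ) : ℝ) * Real.log (p i) = 0 then 1 else 0) :=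
    HasMean.sum fun e _ => (hasMean_exp _).const_mul _
  have hval : (∑ e ∈ Fintype.piFinset fun _ : ι => ({-1, 0, 1} : Finset ℤ),
        (∏ i, rieszWeight (θ i) (e i)) *
          if ∑ i, ((e i - ind i : ℤ) : ℝ) * Real.log (p i) = 0 then (1 : ℂ) else 0) =
      ∏ i ∈ A, (θ i / 2) := by
    rw [Finset.sum_eq_single ind]
    · simp only [sub_self, Int.cast_zero, zero_mul, Finset.sum_const_zero, if_true, mul_one]
      rw [← Finset.prod_subset (Finset.subset_univ A)]
      · exact Finset.prod_congr rfl fun i hi => by simp [hind, hi, rieszWeight]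
      · intro i _ hi
        simp [hind, hi, rieszWeight]
    · intro e _ he
      rw [if_neg, mul_zero]
      intro h0
      refine he (funext fun i => ?_)
      have := congrFun (eq_zero_of_sum_mul_log_prime_eq_zero hp hinj h0) i
      simpa [sub_eq_zero] using this
    · intro h
      refine absurd (Fintype.mem_piFinset.2 fun i => ?_) h
      simp only [hind]; split_ifs <;> simp
  rw [hval] at hM
  exact (funext hF : (fun t : ℝ => _) = _) ▸ hM

/-- A bound for a Dirichlet polynomial on the imaginary axis, with square-free frequencies,
controls its values at all points of the polydisc. -/
theorem norm_sum_prod_le_of_forall_norm_le {ι κ : Type*} [Fintype ι] [DecidableEq ι] {p : ι → ℕ}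
    (hp : ∀ i, (p i).Prime) (hinj : Function.Injective p) {θ : ι → ℂ} (hθ : ∀ i, ‖θ i‖ ≤ 1)
    (T : Finset κ) (c : κ → ℂ) (A : κ → Finset ι) {C : ℝ}
    (h : ∀ t : ℝ, ‖∑ k ∈ T, c k * ∏ i ∈ A k,
      Complex.exp (-(Complex.I * (t * Real.log (p i) : ℝ)))‖ ≤ C) :
    ‖∑ k ∈ T, c k * ∏ i ∈ A k, (θ i / 2)‖ ≤ C := by
  have hK := hasMean_rieszProduct_mul hp hinj θ ∅
  simp only [Finset.prod_empty, mul_one] at hK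
  have hM := HasMean.sum (s := T) fun k _ =>
    (hasMean_rieszProduct_mul hp hinj θ (A k)).const_mul (c k)
  refine hM.norm_le hK fun t => ?_
  set K : ℝ := ∏ i, (1 + (θ i * Complex.exp (Complex.I * (t * Real.log (p i) : ℝ))).re) with hKd
  -- Positivity of the kernel is where the bound 1 on the moduli of the θ i is needed.
  have hK0 : 0 ≤ K := by
    refine Finset.prod_nonneg fun i _ => ?_
    have h1 := Complex.abs_re_le_norm (θ i * Complex.exp (Complex.I * (t * Real.log (p i) : ℝ)))
    rw [norm_mul, mul_comm Complex.I, Complex.norm_exp_ofReal_mul_I, mul_one] at h1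
    have h2 := (abs_le.1 (h1.trans (hθ i))).1
    rw [mul_comm Complex.I]
    linarith
  have e : ∑ k ∈ T, c k * ((K : ℂ) * ∏ i ∈ A k,
      Complex.exp (-(Complex.I * (t * Real.log (p i) : ℝ)))) = K * ∑ k ∈ T, c k * ∏ i ∈ A k,
      Complex.exp (-(Complex.I * (t * Real.log (p i) : ℝ))) := by
    rw [Finset.mul_sum]
    exact Finset.sum_congr rfl fun k _ => by ring
  rw [e, norm_mul, Complex.norm_real, Real.norm_eq_abs, abs_of_nonneg hK0, mul_comm]
  gcongr
  exact h t

/-! ### The size of the primes -/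

theorem le_kthPrime (k : ℕ) : k ≤ kthPrime k := by
  have := Nat.add_two_le_nth_prime (k - 1)
  unfold kthPrime; omega

theorem kthPrime_mono : Monotone kthPrime := fun _ _ h =>
  (Nat.nth_strictMono Nat.infinite_setOfPred_prime).monotone (Nat.sub_le_sub_right h 1)

theorem primeCounting_kthPrime {k : ℕ} (hk : 1 ≤ k) : Nat.primeCounting (kthPrime k) = k := by
  have h1 : Nat.primeCounting' (kthPrime k) = k - 1 := Nat.primeCounting'_nth_eq _
  rw [Nat.primeCounting_eq_primeCounting'_succ, Nat.primeCounting', Nat.count_succ,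
    if_pos (kthPrime_prime k)]
  rw [Nat.primeCounting'] at h1
  omega

/-- Chebyshev's lower bound for the prime counting function at the k-th prime p gives p = O(k log
p), and the logarithm is absorbed into p^η. The value η = δ/(1 + δ) makes 1 - η the inverse of 1 +
δ. -/
theorem exists_kthPrime_le {δ : ℝ} (hδ : 0 < δ) :
    ∃ C : ℝ, 0 < C ∧ ∀ k : ℕ, 1 ≤ k → (kthPrime k : ℝ) ≤ C * (k : ℝ) ^ (1 + δ) := by
  set η : ℝ := δ / (1 + δ) with hη
  have hη0 : 0 < η := by positivity
  have hη1 : (1 - η) * (1 + δ) = 1 := by rw [hη]; field_simp; ring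
  have hlog2 : 0 < Real.log 2 := Real.log_pos one_lt_two
  refine ⟨(3 / (η * Real.log 2)) ^ (1 + δ), by positivity, fun k hk => ?_⟩
  set p := kthPrime k with hp
  have hp2 : (2 : ℝ) ≤ p := by exact_mod_cast (kthPrime_prime k).two_le
  have hk1 : (1 : ℝ) ≤ k := by exact_mod_cast hk
  have hlogp : 0 < Real.log p := Real.log_pos (by linarith)
  have h1 := Chebyshev.pi_ge p
  rw [primeCounting_kthPrime hk, div_le_iff₀ hlogp] at h1
  have h2 : Real.log (p + 1) ≤ 2 * Real.log p := by
    rw [← Real.log_rpow (by linarith)]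
    refine Real.log_le_log (by linarith) ?_
    rw [Real.rpow_two]; nlinarith
  have h3 : p * Real.log 2 ≤ 3 * k * ((p : ℝ) ^ η / η) := by
    calc p * Real.log 2 ≤ 3 * k * Real.log p := by nlinarith
      _ ≤ _ := by gcongr; exact Real.log_le_rpow_div (by linarith) hη0
  have h4 : (p : ℝ) ^ (1 - η) ≤ 3 / (η * Real.log 2) * k := by
    rw [Real.rpow_sub (by linarith), Real.rpow_one, div_le_iff₀ (by positivity)]
    calc (p : ℝ) = p * Real.log 2 / Real.log 2 := by field_simp
      _ ≤ 3 * k * ((p : ℝ) ^ η / η) / Real.log 2 := by gcongr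
      _ = _ := by field_simp
  calc (p : ℝ) = ((p : ℝ) ^ (1 - η)) ^ (1 + δ) := by
        rw [← Real.rpow_mul (by linarith), hη1, Real.rpow_one]
    _ ≤ (3 / (η * Real.log 2) * k) ^ (1 + δ) := by gcongr
    _ = _ := Real.mul_rpow (by positivity) (by positivity)

/-- Powers of the size of the primes of level `L`, up to `2 ^ (ε * L)`. -/
theorem exists_rpow_le (σ : ℝ) {ε : ℝ} (hε : 0 < ε) :
    ∃ C : ℝ, 0 < C ∧ ∀ (L : ℕ) (u : ℝ), (2 : ℝ) ^ L ≤ u → u ≤ kthPrime (6 * 2 ^ L) →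
      u ^ σ ≤ C * ((2 : ℝ) ^ L) ^ (σ + ε) := by
  have hN : ∀ L : ℕ, (1 : ℝ) ≤ 2 ^ L := fun L => one_le_pow₀ one_le_two
  rcases le_total σ 0 with hσ | hσ
  · refine ⟨1, one_pos, fun L u h1 _ => ?_⟩
    have h0 : (0 : ℝ) < 2 ^ L := by positivity
    calc u ^ σ ≤ ((2 : ℝ) ^ L) ^ σ := Real.rpow_le_rpow_of_nonpos h0 h1 hσ
      _ ≤ ((2 : ℝ) ^ L) ^ (σ + ε) := Real.rpow_le_rpow_of_exponent_le (hN L) (by linarith)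
      _ = _ := (one_mul _).symm
  -- Dividing by σ + 1 rather than σ covers σ = 0 and still gives δ σ ≤ ε.
  · obtain ⟨C, hC, hk⟩ := exists_kthPrime_le (δ := ε / (σ + 1)) (by positivity)
    refine ⟨(C * 6 ^ (1 + ε / (σ + 1))) ^ σ, by positivity, fun L u h1 h2 => ?_⟩
    have h0 : (0 : ℝ) < 2 ^ L := by positivity
    have h3 := hk (6 * 2 ^ L) (by have := Nat.one_le_two_pow (n := L); omega)
    push_cast at h3
    calc u ^ σ ≤ (C * (6 * (2 : ℝ) ^ L) ^ (1 + ε / (σ + 1))) ^ σ := by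
          have := h0.trans_le h1
          gcongr
          linarith
      _ = (C * 6 ^ (1 + ε / (σ + 1))) ^ σ * ((2 : ℝ) ^ L) ^ ((1 + ε / (σ + 1)) * σ) := by
          rw [Real.mul_rpow (by positivity) h0.le, ← mul_assoc, Real.mul_rpow (by positivity)
            (by positivity), ← Real.rpow_mul h0.le]
      _ ≤ _ := by
          gcongr
          · exact hN L
          · have : ε / (σ + 1) * σ ≤ ε := by
              rw [div_mul_eq_mul_div, div_le_iff₀ (by positivity)]; nlinarith
            linarith

/-! ### Abel summation -/

theorem norm_exp_sub_exp_le {s : ℂ} {a b M : ℝ} (hab : a ≤ b)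
    (hM : ∀ u ∈ Set.Icc a b, Real.exp (-s.re * u) ≤ M) :
    ‖Complex.exp (-s * b) - Complex.exp (-s * a)‖ ≤ ‖s‖ * M * (b - a) := by
  have hd : ∀ u ∈ Set.Icc a b, HasDerivWithinAt (fun u : ℝ => Complex.exp (-s * u))
      (Complex.exp (-s * u) * -s) (Set.Icc a b) u := by
    intro u _
    have h1 : HasDerivAt (fun u : ℂ => Complex.exp (-s * u)) (Complex.exp (-s * u) * -s) (u : ℂ) := by
      simpa using ((hasDerivAt_id (u : ℂ)).const_mul (-s)).cexp
    exact h1.comp_ofReal.hasDerivWithinAt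
  have := (convex_Icc a b).norm_image_sub_le_of_norm_hasDerivWithin_le (C := ‖s‖ * M) hd
    (fun u hu => by
      rw [norm_mul, norm_neg, mul_comm, Complex.norm_exp]
      gcongr
      simpa using hM u hu) (Set.left_mem_Icc.2 hab) (Set.right_mem_Icc.2 hab)
  rwa [Real.norm_eq_abs, abs_of_nonneg (by linarith)] at this

/-- Abel summation against `q ^ (-s)` for an increasing sequence `q`. -/
theorem norm_sum_mul_cpow_le {w : ℕ → ℂ} {q : ℕ → ℕ} (hq : Monotone q) {T : ℕ} {s : ℂ}
    {lo hi V M : ℝ} (hlo : 1 ≤ lo) (hqlo : ∀ k < T, lo ≤ q k) (hqhi : ∀ k < T, (q k : ℝ) ≤ hi)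
    (hlohi : lo ≤ hi)
    (hw : ∀ m ≤ T, ‖∑ k ∈ Finset.range m, w k‖ ≤ V)
    (hM : ∀ u : ℝ, lo ≤ u → u ≤ hi → u ^ (-s.re) ≤ M) :
    ‖∑ k ∈ Finset.range T, w k * (q k : ℂ) ^ (-s)‖ ≤ V * (M * (1 + ‖s‖ * Real.log hi)) := by
  have hV : 0 ≤ V := (norm_nonneg _).trans (hw 0 T.zero_le)
  have hM0 : 0 ≤ M := (Real.rpow_nonneg (by linarith) _).trans (hM lo le_rfl hlohi)
  have hlog : 0 ≤ Real.log hi := Real.log_nonneg (by linarith)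
  rcases Nat.eq_zero_or_pos T with rfl | hT
  · simp only [Finset.range_zero, Finset.sum_empty, norm_zero]; positivity
  have hpos : ∀ k < T, (0 : ℝ) < q k := fun k hk => by linarith [hqlo k hk]
  have hexp : ∀ k < T, (q k : ℂ) ^ (-s) = Complex.exp (-s * (Real.log (q k) : ℝ)) := by
    intro k hk
    rw [Complex.cpow_def_of_ne_zero (by exact_mod_cast (hpos k hk).ne'), Complex.natCast_log,
      mul_comm]
  have hnorm : ∀ k < T, ‖(q k : ℂ) ^ (-s)‖ ≤ M := by
    intro k hk
    have : (0 : ℝ) < q k := hpos k hk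
    rw [Complex.norm_natCast_cpow_of_pos (by exact_mod_cast this)]
    exact hM _ (hqlo k hk) (hqhi k hk)
  have hdiff : ∀ k ∈ Finset.range (T - 1), ‖((q (k + 1) : ℂ) ^ (-s) - (q k : ℂ) ^ (-s)) •
      ∑ j ∈ Finset.range (k + 1), w j‖ ≤
      ‖s‖ * M * (Real.log (q (k + 1)) - Real.log (q k)) * V := by
    intro k hk
    rw [Finset.mem_range] at hk
    have hk0 : k < T := by omega
    have hk1 : k + 1 < T := by omega
    have hle : Real.log (q k) ≤ Real.log (q (k + 1)) :=
      Real.log_le_log (hpos k hk0) (by exact_mod_cast hq (Nat.le_succ k))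
    rw [smul_eq_mul, norm_mul, hexp k hk0, hexp (k + 1) hk1]
    refine mul_le_mul ?_ (hw _ hk1.le) (norm_nonneg _) (by
      have := sub_nonneg.2 hle
      positivity)
    refine norm_exp_sub_exp_le hle fun u hu => ?_
    have e : Real.exp (-s.re * u) = Real.exp u ^ (-s.re) := by
      rw [← Real.exp_mul, mul_comm]
    rw [e]
    refine hM _ ?_ ?_
    · exact (hqlo k hk0).trans ((Real.log_le_iff_le_exp (hpos k hk0)).1 hu.1)
    · exact ((Real.le_log_iff_exp_le (hpos _ hk1)).1 hu.2).trans (hqhi _ hk1)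
  have hparts := Finset.sum_range_by_parts (fun k => (q k : ℂ) ^ (-s)) w T
  simp only [smul_eq_mul] at hparts hdiff
  rw [Finset.sum_congr rfl fun k _ => mul_comm (w k) _, hparts]
  refine (norm_sub_le _ _).trans ?_
  have h1 : ‖(q (T - 1) : ℂ) ^ (-s) * ∑ i ∈ Finset.range T, w i‖ ≤ M * V := by
    rw [norm_mul]
    exact mul_le_mul (hnorm _ (by omega)) (hw _ le_rfl) (norm_nonneg _) hM0
  have h2 : ‖∑ k ∈ Finset.range (T - 1), ((q (k + 1) : ℂ) ^ (-s) - (q k : ℂ) ^ (-s)) *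
      ∑ j ∈ Finset.range (k + 1), w j‖ ≤ ‖s‖ * M * Real.log hi * V := by
    refine (norm_sum_le_of_le _ hdiff).trans ?_
    -- The increments of log q telescope, so the total variation of q^(-s) costs only a factor log
    -- hi.
    rw [← Finset.sum_mul, ← Finset.mul_sum, Finset.sum_range_sub (fun k => Real.log (q k))]
    gcongr
    have h3 : Real.log (q (T - 1)) ≤ Real.log hi :=
      Real.log_le_log (hpos _ (by omega)) (hqhi _ (by omega))
    have h4 : 0 ≤ Real.log (q 0) := Real.log_natCast_nonneg _
    linarith
  calc _ ≤ M * V + ‖s‖ * M * Real.log hi * V := add_le_add h1 h2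
    _ = _ := by ring

/-- Turns the cutoff n ≤ M into an initial segment of the innermost sum; T does not depend on the
summand. -/
theorem exists_sum_ite_le_eq_sum_range {f : ℕ → ℕ} (hf : Monotone f) (N M : ℕ) :
    ∃ T ≤ N, ∀ g : ℕ → ℂ, ∑ i ∈ Finset.range N, (if f i ≤ M then g i else 0) =
      ∑ i ∈ Finset.range T, g i := by
  induction N with
  | zero => exact ⟨0, le_rfl, fun g => by simp⟩
  | succ N ih =>
    by_cases h : f N ≤ M
    · refine ⟨N + 1, le_rfl, fun g => Finset.sum_congr rfl fun i hi => if_pos ?_⟩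
      exact (hf (Nat.lt_succ_iff.1 (Finset.mem_range.1 hi))).trans h
    · obtain ⟨T, hT, hg⟩ := ih
      exact ⟨T, hT.trans (Nat.le_succ N), fun g => by
        rw [Finset.sum_range_succ, if_neg h, add_zero, hg]⟩

/-! ### Decomposition into levels, convergence and upper bounds -/

/-- The part of the series of level `L`, without the factor `β L`. -/
noncomputable def levelSum (ρ₁ : ℝ) (s : ℂ) (L : ℕ) : ℂ :=
  ∑ i₁ ∈ Finset.range (firstSize ρ₁ L), ∑ i₂ ∈ Finset.range (2 ^ L), ∑ i₃ ∈ Finset.range (2 ^ L),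
    nodeCoeff ρ₁ (fun _ => 1) L i₁ i₂ i₃ * (node L i₁ i₂ i₃ : ℂ) ^ (-s)

/-- The terms `n ≤ M` of `levelSum`. -/
noncomputable def levelPartial (ρ₁ : ℝ) (s : ℂ) (L M : ℕ) : ℂ :=
  ∑ i₁ ∈ Finset.range (firstSize ρ₁ L), ∑ i₂ ∈ Finset.range (2 ^ L), ∑ i₃ ∈ Finset.range (2 ^ L),
    if node L i₁ i₂ i₃ ≤ M then
      nodeCoeff ρ₁ (fun _ => 1) L i₁ i₂ i₃ * (node L i₁ i₂ i₃ : ℂ) ^ (-s) else 0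

theorem nodeCoeff_eq (ρ₁ : ℝ) (β : ℕ → ℂ) (L i₁ i₂ i₃ : ℕ) :
    nodeCoeff ρ₁ β L i₁ i₂ i₃ = β L * nodeCoeff ρ₁ (fun _ => 1) L i₁ i₂ i₃ := by
  unfold nodeCoeff; ring

theorem node_pos (L i₁ i₂ i₃ : ℕ) : 0 < node L i₁ i₂ i₃ :=
  Nat.mul_pos (Nat.mul_pos (kthPrime_prime _).pos (kthPrime_prime _).pos) (kthPrime_prime _).pos

theorem node_mono (L i₁ i₂ : ℕ) : Monotone (node L i₁ i₂) := fun _ _ h =>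
  Nat.mul_le_mul_left _ (kthPrime_mono (Nat.add_le_add_left h _))

theorem node_cpow (L i₁ i₂ i₃ : ℕ) (s : ℂ) : (node L i₁ i₂ i₃ : ℂ) ^ s =
    (kthPrime (3 * 2 ^ L + i₁) : ℂ) ^ s * (kthPrime (4 * 2 ^ L + i₂) : ℂ) ^ s *
      (kthPrime (5 * 2 ^ L + i₃) : ℂ) ^ s := by
  unfold node
  rw [Nat.cast_mul, Complex.natCast_mul_natCast_cpow, Nat.cast_mul,
    Complex.natCast_mul_natCast_cpow]

theorem partialSum_coeff (ρ₁ : ℝ) (β : ℕ → ℂ) (s : ℂ) (M : ℕ) :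
    partialSum (coeff ρ₁ β) s M = ∑ L ∈ Finset.Icc 1 M, β L * levelPartial ρ₁ s L M := by
  have h1 : ∀ n ∈ Finset.Icc 1 M, coeff ρ₁ β n * (n : ℂ) ^ (-s) =
      ∑ L ∈ Finset.Icc 1 M, ∑ i₁ ∈ Finset.range (firstSize ρ₁ L),
      ∑ i₂ ∈ Finset.range (2 ^ L), ∑ i₃ ∈ Finset.range (2 ^ L),
      if n = node L i₁ i₂ i₃ then nodeCoeff ρ₁ β L i₁ i₂ i₃ * (n : ℂ) ^ (-s) else 0 := by
    intro n hn
    rw [Finset.mem_Icc] at hn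
    unfold coeff
    rw [Finset.sum_mul]
    rw [Finset.sum_subset (Finset.Icc_subset_Icc_right hn.2)]
    · simp only [Finset.sum_mul, ite_mul, zero_mul]
    · intro L hL hL'
      have hLn : n < L := by
        simp only [Finset.mem_Icc, not_and, not_le] at hL hL'
        exact hL' hL.1
      rw [Finset.sum_eq_zero, zero_mul]
      intro i _
      refine Finset.sum_eq_zero fun j _ => Finset.sum_eq_zero fun k _ => if_neg ?_
      have := le_node L i j k
      omega
  unfold partialSum levelPartial
  rw [Finset.sum_congr rfl h1, Finset.sum_comm]
  refine Finset.sum_congr rfl fun L _ => ?_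
  rw [Finset.sum_comm, Finset.mul_sum]
  refine Finset.sum_congr rfl fun i _ => ?_
  rw [Finset.sum_comm, Finset.mul_sum]
  refine Finset.sum_congr rfl fun j _ => ?_
  rw [Finset.sum_comm, Finset.mul_sum]
  refine Finset.sum_congr rfl fun k _ => ?_
  have hpos := node_pos L i j k
  by_cases h : node L i j k ≤ M
  · rw [if_pos h, Finset.sum_eq_single (node L i j k) (fun n _ hn => if_neg hn)
      (fun hn => absurd (Finset.mem_Icc.2 ⟨hpos, h⟩) hn), if_pos rfl, nodeCoeff_eq, mul_assoc]
  · rw [if_neg h, mul_zero]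
    refine Finset.sum_eq_zero fun n hn => if_neg ?_
    rw [Finset.mem_Icc] at hn
    omega

theorem levelPartial_eq_zero {ρ₁ : ℝ} {s : ℂ} {L M : ℕ} (h : M < L) : levelPartial ρ₁ s L M = 0 := by
  refine Finset.sum_eq_zero fun i _ => Finset.sum_eq_zero fun j _ => Finset.sum_eq_zero
    fun k _ => if_neg ?_
  have := le_node L i j k
  omega

theorem tendsto_levelPartial (ρ₁ : ℝ) (s : ℂ) (L : ℕ) :
    Tendsto (levelPartial ρ₁ s L) atTop (𝓝 (levelSum ρ₁ s L)) := by
  refine tendsto_finsetSum _ fun i _ => tendsto_finsetSum _ fun j _ => tendsto_finsetSum _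
    fun k _ => ?_
  refine tendsto_const_nhds.congr' ?_
  filter_upwards [eventually_ge_atTop (node L i j k)] with M hM
  rw [if_pos hM]

theorem norm_nodeCoeff (ρ₁ : ℝ) {β : ℕ → ℂ} {L : ℕ} (hβ : ‖β L‖ = 1) (i₁ i₂ i₃ : ℕ) :
    ‖nodeCoeff ρ₁ β L i₁ i₂ i₃‖ = ((2 : ℝ) ^ L) ^ (-(2 * (ρ₁ + 2) / 3)) := by
  unfold nodeCoeff
  rw [norm_mul, norm_mul, norm_mul, norm_pow, norm_pow, norm_rootOfUnity, hβ, Complex.norm_real,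
    Real.norm_eq_abs, abs_of_nonneg (by positivity), one_pow, one_pow, one_mul, mul_one, mul_one,
    ← Real.rpow_natCast 2 L, ← Real.rpow_mul two_pos.le, mul_comm]

/-- The bound for one ratio is as bad as N, but over all j < N it is logarithmic on average. This
average is the whole saving behind the estimate of σ_c. -/
theorem exists_bound_norm_sum_rootOfUnity_pow (N : ℕ) (hN : 0 < N) :
    ∃ V : ℕ → ℝ, (∀ j < N, ∀ m ≤ N, ‖∑ k ∈ Finset.range m, (rootOfUnity N ^ j) ^ k‖ ≤ V j) ∧
      ∑ j ∈ Finset.range N, V j ≤ N * (2 + Real.log N) := by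
  refine ⟨fun j => if j = 0 then N else 2 * ‖1 - rootOfUnity N ^ j‖⁻¹, fun j hj m hm => ?_, ?_⟩
  · by_cases h : j = 0
    · subst h
      simpa using hm
    · simp only [if_neg h]
      refine norm_geom_sum_le ?_ ?_ _
      · rw [norm_pow, norm_rootOfUnity, one_pow]
      · exact (isPrimitiveRoot_rootOfUnity hN.ne').pow_ne_one_of_pos_of_lt h hj
  · rw [Finset.range_eq_Ico, Finset.sum_eq_sum_Ico_succ_bot hN, if_pos rfl]
    have : ∑ j ∈ Finset.Ico (0 + 1) N, (if j = 0 then (N : ℝ) else 2 * ‖1 - rootOfUnity N ^ j‖⁻¹) =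
        2 * ∑ j ∈ Finset.Ico 1 N, ‖1 - rootOfUnity N ^ j‖⁻¹ := by
      rw [Finset.mul_sum]
      refine Finset.sum_congr rfl fun j hj => if_neg ?_
      have := (Finset.mem_Ico.1 hj).1
      omega
    rw [this]
    linarith [sum_inv_norm_one_sub_rootOfUnity_pow_le N]

theorem two_pow_le_kthPrime {L k : ℕ} (hk : 2 ^ L ≤ k) : (2 : ℝ) ^ L ≤ kthPrime k := by
  exact_mod_cast hk.trans (le_kthPrime k)

theorem kthPrime_le_of_le {k l : ℕ} (hk : k ≤ l) : (kthPrime k : ℝ) ≤ kthPrime l := by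
  exact_mod_cast kthPrime_mono hk

theorem norm_kthPrime_cpow (k : ℕ) (s : ℂ) : ‖(kthPrime k : ℂ) ^ s‖ = (kthPrime k : ℝ) ^ s.re :=
  Complex.norm_natCast_cpow_of_pos (kthPrime_prime k).pos s

/-- The point at which the cutoff falls depends on i₁ and i₂, so only cancellation in i₃ is used. It
survives the truncation and, by Abel summation, the factors p^(-s). The sums over i₁ and i₂ are
taken in modulus. -/
theorem norm_levelPartial_le {ρ₁ : ℝ} (hρ : ρ₁ ≤ 1) {s : ℂ} {L : ℕ} {B : ℝ}
    (hB : ∀ u : ℝ, (2 : ℝ) ^ L ≤ u → u ≤ kthPrime (6 * 2 ^ L) → u ^ (-s.re) ≤ B) (M : ℕ) :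
    ‖levelPartial ρ₁ s L M‖ ≤ ((2 : ℝ) ^ L) ^ (-(2 * (ρ₁ + 2) / 3)) * firstSize ρ₁ L *
      (2 ^ L * (2 + Real.log (2 ^ L))) * B ^ 3 *
        (1 + ‖s‖ * Real.log (kthPrime (6 * 2 ^ L))) := by
  have hN0 : 0 < 2 ^ L := Nat.two_pow_pos L
  obtain ⟨V, hV, hVs⟩ := exists_bound_norm_sum_rootOfUnity_pow (2 ^ L) hN0
  have hlohi : (2 : ℝ) ^ L ≤ kthPrime (6 * 2 ^ L) := two_pow_le_kthPrime (by omega)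
  have hB0 : 0 ≤ B := (Real.rpow_nonneg (by positivity) _).trans (hB _ le_rfl hlohi)
  have hprime : ∀ k, 2 ^ L ≤ k → k ≤ 6 * 2 ^ L → ‖(kthPrime k : ℂ) ^ (-s)‖ ≤ B := by
    intro k h1 h2
    rw [norm_kthPrime_cpow]
    exact hB _ (two_pow_le_kthPrime h1) (kthPrime_le_of_le h2)
  set X : ℝ := ((2 : ℝ) ^ L) ^ (-(2 * (ρ₁ + 2) / 3)) with hX
  have hX0 : 0 ≤ X := by positivity
  set D : ℝ := 1 + ‖s‖ * Real.log (kthPrime (6 * 2 ^ L)) with hD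
  have hD0 : 0 ≤ D := by
    have := Real.log_natCast_nonneg (kthPrime (6 * 2 ^ L))
    positivity
  have hrow : ∀ i < firstSize ρ₁ L, ∀ j < 2 ^ L, ‖∑ k ∈ Finset.range (2 ^ L),
      if node L i j k ≤ M then
        nodeCoeff ρ₁ (fun _ => 1) L i j k * (node L i j k : ℂ) ^ (-s) else 0‖ ≤
      X * B ^ 3 * D * V j := by
    intro i hi j hj
    have hi' := hi.trans_le (firstSize_le hρ L)
    obtain ⟨T, hT, hg⟩ := exists_sum_ite_le_eq_sum_range (node_mono L i j) (2 ^ L) M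
    rw [hg]
    set A : ℂ := nodeCoeff ρ₁ (fun _ => 1) L i j 0 * ((kthPrime (3 * 2 ^ L + i) : ℂ) ^ (-s) *
      (kthPrime (4 * 2 ^ L + j) : ℂ) ^ (-s)) with hA
    have e : ∀ k, nodeCoeff ρ₁ (fun _ => 1) L i j k * (node L i j k : ℂ) ^ (-s) =
        A * ((rootOfUnity (2 ^ L) ^ j) ^ k * (kthPrime (5 * 2 ^ L + k) : ℂ) ^ (-s)) := by
      intro k
      rw [node_cpow, hA]
      unfold nodeCoeff
      ring
    rw [Finset.sum_congr rfl fun k _ => e k, ← Finset.mul_sum, norm_mul]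
    have hAn : ‖A‖ ≤ X * (B * B) := by
      rw [hA, norm_mul, norm_mul, norm_nodeCoeff ρ₁ (by simp)]
      have h1 := hprime (3 * 2 ^ L + i) (by omega) (by omega)
      have h2 := hprime (4 * 2 ^ L + j) (by omega) (by omega)
      gcongr
    have hS := norm_sum_mul_cpow_le (w := fun k => (rootOfUnity (2 ^ L) ^ j) ^ k)
      (q := fun k => kthPrime (5 * 2 ^ L + k)) (T := T) (s := s) (V := V j) (M := B)
      (lo := 2 ^ L) (hi := kthPrime (6 * 2 ^ L))
      (fun a b h => kthPrime_mono (Nat.add_le_add_left h _)) (one_le_pow₀ one_le_two)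
      (fun k _ => two_pow_le_kthPrime (by omega)) (fun k hk => kthPrime_le_of_le (by omega))
      hlohi (fun m hm => hV j hj m (hm.trans hT)) hB
    calc _ ≤ X * (B * B) * (V j * (B * D)) :=
          mul_le_mul hAn hS (norm_nonneg _) (by positivity)
      _ = _ := by ring
  calc ‖levelPartial ρ₁ s L M‖ ≤ ∑ i ∈ Finset.range (firstSize ρ₁ L),
        ∑ j ∈ Finset.range (2 ^ L), X * B ^ 3 * D * V j :=
        norm_sum_le_of_le _ fun i hi => norm_sum_le_of_le _ fun j hj =>
          hrow i (Finset.mem_range.1 hi) j (Finset.mem_range.1 hj)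
    _ = firstSize ρ₁ L * (X * B ^ 3 * D * ∑ j ∈ Finset.range (2 ^ L), V j) := by
        rw [Finset.sum_const, Finset.card_range, nsmul_eq_mul, ← Finset.mul_sum]
    _ ≤ firstSize ρ₁ L * (X * B ^ 3 * D * ((2 : ℝ) ^ L * (2 + Real.log (2 ^ L)))) := by
        push_cast at hVs
        gcongr
    _ = _ := by ring

theorem firstSize_le_rpow (ρ₁ : ℝ) (L : ℕ) : (firstSize ρ₁ L : ℝ) ≤ ((2 : ℝ) ^ L) ^ ρ₁ := by
  unfold firstSize
  rw [← Real.rpow_natCast 2 L, ← Real.rpow_mul two_pos.le, mul_comm (L : ℝ)]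
  exact Nat.floor_le (by positivity)

theorem rpow_le_firstSize {ρ₁ : ℝ} (hρ : 0 ≤ ρ₁) (L : ℕ) :
    ((2 : ℝ) ^ L) ^ ρ₁ / 2 ≤ firstSize ρ₁ L := by
  unfold firstSize
  rw [← Real.rpow_natCast 2 L, ← Real.rpow_mul two_pos.le, mul_comm (L : ℝ)]
  have h1 : (1 : ℝ) ≤ (2 : ℝ) ^ (ρ₁ * L) := Real.one_le_rpow one_le_two (by positivity)
  have h2 := Nat.lt_floor_add_one ((2 : ℝ) ^ (ρ₁ * L))
  have h3 : (1 : ℝ) ≤ ⌊(2 : ℝ) ^ (ρ₁ * L)⌋₊ := by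
    exact_mod_cast Nat.le_floor (by simpa using h1)
  linarith

theorem two_pow_rpow (a : ℝ) (L : ℕ) : ((2 : ℝ) ^ L) ^ a = ((2 : ℝ) ^ a) ^ L := by
  rw [← Real.rpow_natCast, ← Real.rpow_natCast, ← Real.rpow_mul two_pos.le,
    ← Real.rpow_mul two_pos.le, mul_comm]

theorem exists_norm_levelPartial_le {ρ₁ : ℝ} (hρ : ρ₁ ≤ 1) {s : ℂ} (hs : (ρ₁ - 1) / 9 < s.re) :
    ∃ K q : ℝ, 0 ≤ q ∧ q < 1 ∧ ∀ L M, ‖levelPartial ρ₁ s L M‖ ≤ K * q ^ L := by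
  set d : ℝ := s.re - (ρ₁ - 1) / 9 with hd
  have hd0 : 0 < d := sub_pos.2 hs
  -- Without losses the exponent is ρ₁ + 1 - X - 3 Re s = -3d. The losses are ε from the logarithm
  -- of N, 3ε from the three primes and 2ε from the Abel summation factor.
  set ε : ℝ := d / 6 with hε
  have hε0 : 0 < ε := by positivity
  obtain ⟨C, hC, hCu⟩ := exists_rpow_le (-s.re) hε0
  obtain ⟨C', hC', hCu'⟩ := exists_rpow_le ε hε0
  refine ⟨(2 + 1 / ε) * C ^ 3 * (1 + ‖s‖ * (C' / ε)), (2 : ℝ) ^ (-(3 * d) + 6 * ε),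
    by positivity, Real.rpow_lt_one_of_one_lt_of_neg one_lt_two (by rw [hε]; linarith),
    fun L M => ?_⟩
  refine (norm_levelPartial_le hρ (hCu L) M).trans ?_
  rw [← two_pow_rpow]
  set N : ℝ := (2 : ℝ) ^ L with hN
  have hN1 : 1 ≤ N := one_le_pow₀ one_le_two
  have hN0 : 0 < N := by positivity
  have hNe : ∀ a : ℝ, 0 ≤ a → 1 ≤ N ^ a := fun a ha => Real.one_le_rpow hN1 ha
  have h1 : 2 + Real.log N ≤ (2 + 1 / ε) * N ^ ε := by
    have := Real.log_le_rpow_div hN0.le hε0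
    have := hNe ε hε0.le
    calc 2 + Real.log N ≤ 2 * N ^ ε + N ^ ε / ε := by linarith
      _ = _ := by ring
  have hlohi : N ≤ kthPrime (6 * 2 ^ L) := two_pow_le_kthPrime (by omega)
  have h2 : 1 + ‖s‖ * Real.log (kthPrime (6 * 2 ^ L)) ≤ (1 + ‖s‖ * (C' / ε)) * N ^ (ε + ε) := by
    have h3 : Real.log (kthPrime (6 * 2 ^ L)) ≤ C' / ε * N ^ (ε + ε) := by
      calc _ ≤ (kthPrime (6 * 2 ^ L) : ℝ) ^ ε / ε := Real.log_le_rpow_div (by positivity) hε0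
        _ ≤ C' * N ^ (ε + ε) / ε := by gcongr; exact hCu' L _ hlohi le_rfl
        _ = _ := by ring
    have h4 := hNe (ε + ε) (by positivity)
    calc _ ≤ N ^ (ε + ε) + ‖s‖ * (C' / ε * N ^ (ε + ε)) := by gcongr
      _ = _ := by ring
  have h0 : 0 ≤ Real.log N := Real.log_nonneg hN1
  have h0' : 0 ≤ Real.log (kthPrime (6 * 2 ^ L)) := Real.log_natCast_nonneg _
  calc _ ≤ N ^ (-(2 * (ρ₁ + 2) / 3)) * N ^ ρ₁ * (N ^ (1 : ℝ) * ((2 + 1 / ε) * N ^ ε)) *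
        (C * N ^ (-s.re + ε)) ^ 3 * ((1 + ‖s‖ * (C' / ε)) * N ^ (ε + ε)) := by
        rw [Real.rpow_one]
        gcongr
        exact firstSize_le_rpow ρ₁ L
    _ = (2 + 1 / ε) * C ^ 3 * (1 + ‖s‖ * (C' / ε)) * (N ^ (-(2 * (ρ₁ + 2) / 3)) * N ^ ρ₁ *
        N ^ (1 : ℝ) * N ^ ε * N ^ (-s.re + ε) * N ^ (-s.re + ε) * N ^ (-s.re + ε) *
        N ^ (ε + ε)) := by ring
    _ = _ := by
        simp only [← Real.rpow_add hN0]
        congr 2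
        rw [hd]; ring

theorem exists_norm_levelSum_le {ρ₁ : ℝ} (hρ : ρ₁ ≤ 1) {s : ℂ} (hs : (ρ₁ - 1) / 9 < s.re) :
    ∃ K q : ℝ, 0 ≤ q ∧ q < 1 ∧ ∀ L, ‖levelSum ρ₁ s L‖ ≤ K * q ^ L := by
  obtain ⟨K, q, h0, h1, h⟩ := exists_norm_levelPartial_le hρ hs
  exact ⟨K, q, h0, h1, fun L => le_of_tendsto (tendsto_levelPartial ρ₁ s L).norm
    (Eventually.of_forall fun M => h L M)⟩

/-- Dominated convergence over the levels: the geometric majorant is uniform in the cutoff M. -/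
theorem tendsto_partialSum_coeff {ρ₁ : ℝ} (hρ : ρ₁ ≤ 1) {β : ℕ → ℂ} (hβ : ∀ L, ‖β L‖ = 1) {s : ℂ}
    (hs : (ρ₁ - 1) / 9 < s.re) :
    Tendsto (partialSum (coeff ρ₁ β) s) atTop
      (𝓝 (∑' L : ℕ, β (L + 1) * levelSum ρ₁ s (L + 1))) := by
  obtain ⟨K, q, h0, h1, h⟩ := exists_norm_levelPartial_le hρ hs
  have e : ∀ M, partialSum (coeff ρ₁ β) s M =
      ∑' L : ℕ, β (L + 1) * levelPartial ρ₁ s (L + 1) M := by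
    intro M
    rw [partialSum_coeff, tsum_eq_sum (s := Finset.range M)]
    · rw [Finset.range_eq_Ico,
        Finset.sum_Ico_add' (fun L => β L * levelPartial ρ₁ s L M) 0 M 1]
      rfl
    · intro L hL
      rw [Finset.mem_range, not_lt] at hL
      rw [levelPartial_eq_zero (Nat.lt_succ_of_le hL), mul_zero]
  refine (tendsto_tsum_of_dominated_convergence (bound := fun L => K * q ^ (L + 1)) ?_
    (fun L => (tendsto_levelPartial ρ₁ s (L + 1)).const_mul (β (L + 1)))
    (Eventually.of_forall fun M L => ?_)).congr fun M => (e M).symm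
  · simp only [pow_succ, ← mul_assoc]
    exact ((summable_geometric_of_lt_one h0 h1).mul_left K).mul_right q
  · rw [norm_mul, hβ, one_mul]
    exact h _ _

/-- The factors p^(-s) are admissible variables of the trilinear form, and -X + 1 + (1 + ρ₁)/2 = (1
- ρ₁)/6. Since σ ≥ 0, the lower bound p ≥ 2^L suffices, so there is no loss and the bound is uniform
in Im s. -/
theorem norm_levelSum_le {ρ₁ : ℝ} (hρ : ρ₁ ≤ 1) {s : ℂ} {σ : ℝ} (hσ : 0 ≤ σ) (hs : σ ≤ s.re)
    (L : ℕ) : ‖levelSum ρ₁ s L‖ ≤ ((2 : ℝ) ^ ((1 - ρ₁) / 6 - 3 * σ)) ^ L := by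
  rw [← two_pow_rpow]
  set N : ℝ := (2 : ℝ) ^ L with hN
  have hN1 : 1 ≤ N := one_le_pow₀ one_le_two
  have hN0 : 0 < N := by positivity
  have hprime : ∀ k, 2 ^ L ≤ k → ‖(kthPrime k : ℂ) ^ (-s)‖ ≤ N ^ (-σ) := by
    intro k h1
    have h2 : N ≤ kthPrime k := two_pow_le_kthPrime h1
    rw [norm_kthPrime_cpow]
    calc _ ≤ (kthPrime k : ℝ) ^ (-σ) :=
          Real.rpow_le_rpow_of_exponent_le (hN1.trans h2) (by simpa using hs)
      _ ≤ N ^ (-σ) := Real.rpow_le_rpow_of_nonpos hN0 h2 (by linarith)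
  have e : levelSum ρ₁ s L = (((2 : ℝ) ^ (-(2 * (ρ₁ + 2) / 3) * L) : ℝ) : ℂ) *
      ∑ i₁ ∈ Finset.range (firstSize ρ₁ L), ∑ i₂ ∈ Finset.range (2 ^ L),
      ∑ i₃ ∈ Finset.range (2 ^ L), rootOfUnity (2 ^ L) ^ (i₁ * i₂) *
        rootOfUnity (2 ^ L) ^ (i₂ * i₃) * ((kthPrime (3 * 2 ^ L + i₁) : ℂ) ^ (-s) *
        (kthPrime (4 * 2 ^ L + i₂) : ℂ) ^ (-s) * (kthPrime (5 * 2 ^ L + i₃) : ℂ) ^ (-s)) := by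
    unfold levelSum
    simp only [Finset.mul_sum]
    refine Finset.sum_congr rfl fun i _ => Finset.sum_congr rfl fun j _ =>
      Finset.sum_congr rfl fun k _ => ?_
    rw [node_cpow]; unfold nodeCoeff; ring
  have h := norm_trilinear_le (N := 2 ^ L) (firstSize_le hρ L) (ν := N ^ (-σ))
    (x := fun i => (kthPrime (3 * 2 ^ L + i) : ℂ) ^ (-s))
    (y := fun i => (kthPrime (4 * 2 ^ L + i) : ℂ) ^ (-s))
    (z := fun i => (kthPrime (5 * 2 ^ L + i) : ℂ) ^ (-s))
    (fun i _ => hprime _ (by omega)) (fun i _ => hprime _ (by omega))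
    (fun i _ => hprime _ (by omega)) (by positivity)
  rw [e, norm_mul, Complex.norm_real, Real.norm_eq_abs, abs_of_nonneg (by positivity),
    mul_comm _ (L : ℝ), Real.rpow_mul two_pos.le, Real.rpow_natCast]
  push_cast at h
  calc _ ≤ N ^ (-(2 * (ρ₁ + 2) / 3)) * ((N ^ (-σ)) ^ 3 * (N * √(N * N ^ ρ₁))) := by
        refine mul_le_mul_of_nonneg_left (h.trans ?_) (by positivity)
        gcongr
        exact firstSize_le_rpow ρ₁ L
    _ = N ^ (-(2 * (ρ₁ + 2) / 3)) * (N ^ (-σ) * N ^ (-σ) * N ^ (-σ) * (N ^ (1 : ℝ) *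
        (N ^ (1 : ℝ) * N ^ ρ₁) ^ (1 / 2 : ℝ))) := by
        rw [Real.sqrt_eq_rpow, Real.rpow_one]; ring
    _ = _ := by
        simp only [← Real.rpow_add hN0, ← Real.rpow_mul hN0.le]
        congr 1; ring

/-! ### Unboundedness on the imaginary axis -/

theorem firstSize_pos {ρ₁ : ℝ} (hρ : 0 ≤ ρ₁) (L : ℕ) : 0 < firstSize ρ₁ L := by
  have h := rpow_le_firstSize hρ L
  have h0 : (0 : ℝ) < ((2 : ℝ) ^ L) ^ ρ₁ / 2 := by positivity
  exact_mod_cast h0.trans_le h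

/-- The three blocks of primes are disjoint, so each prime is an independent variable and the
polydisc principle applies. The factor 8 is 2³: each monomial contains three variables θ / 2. -/
theorem le_of_forall_norm_levelSum_le {ρ₁ : ℝ} (hρ0 : 0 ≤ ρ₁) (hρ : ρ₁ ≤ 1) {L : ℕ} (hL : 1 ≤ L)
    {C : ℝ} (hC : ∀ t : ℝ, ‖levelSum ρ₁ (t * Complex.I) L‖ ≤ C) :
    ((2 : ℝ) ^ L) ^ (-(2 * (ρ₁ + 2) / 3)) * (2 ^ L * √(2 ^ L * firstSize ρ₁ L) /
      √(3 + 2 * Real.log (firstSize ρ₁ L))) / 8 ≤ C := by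
  have hrN := firstSize_le hρ L
  obtain ⟨x, y, z, hx, hy, hz, hxyz⟩ := exists_le_norm_trilinear (N := 2 ^ L)
    ((Nat.even_pow' (by omega)).2 even_two) (firstSize_pos hρ0 L) hrN
  set r := firstSize ρ₁ L with hr
  set p : Fin r ⊕ (Fin (2 ^ L) ⊕ Fin (2 ^ L)) → ℕ := Sum.elim
    (fun i => kthPrime (3 * 2 ^ L + i))
    (Sum.elim (fun i => kthPrime (4 * 2 ^ L + i)) (fun i => kthPrime (5 * 2 ^ L + i))) with hp
  set θ : Fin r ⊕ (Fin (2 ^ L) ⊕ Fin (2 ^ L)) → ℂ := Sum.elim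
    (fun i => x i) (Sum.elim (fun i => y i) (fun i => z i)) with hθ
  have hN0 : 0 < 2 ^ L := Nat.two_pow_pos L
  have hpp : ∀ i, (p i).Prime := by
    rintro (i | i | i) <;> exact kthPrime_prime _
  have hpi : Function.Injective p := by
    rintro (i | i | i) (j | j | j) h <;>
      · have h' := kthPrime_inj (by omega) (by omega) h
        have hi := i.2
        have hj := j.2
        first
          | (exfalso; omega)
          | (have : i = j := Fin.ext (by omega)
             rw [this])
  have hθ1 : ∀ i, ‖θ i‖ ≤ 1 := by
    rintro (i | i | i)
    · exact hx i
    · exact hy i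
    · exact hz i
  have hprod : ∀ (k : Fin r × Fin (2 ^ L) × Fin (2 ^ L))
      (f : Fin r ⊕ (Fin (2 ^ L) ⊕ Fin (2 ^ L)) → ℂ),
      ∏ i ∈ ({Sum.inl k.1, Sum.inr (Sum.inl k.2.1), Sum.inr (Sum.inr k.2.2)} : Finset _), f i =
      f (Sum.inl k.1) * f (Sum.inr (Sum.inl k.2.1)) * f (Sum.inr (Sum.inr k.2.2)) := by
    intro k f
    rw [Finset.prod_insert (by simp), Finset.prod_insert (by simp), Finset.prod_singleton,
      mul_assoc]
  have hsum : ∀ f : ℕ → ℕ → ℕ → ℂ, ∑ k : Fin r × Fin (2 ^ L) × Fin (2 ^ L), f k.1 k.2.1 k.2.2 =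
      ∑ i₁ ∈ Finset.range r, ∑ i₂ ∈ Finset.range (2 ^ L), ∑ i₃ ∈ Finset.range (2 ^ L),
        f i₁ i₂ i₃ := by
    intro f
    simp only [Fintype.sum_prod_type, Finset.sum_range]
  have key := norm_sum_prod_le_of_forall_norm_le hpp hpi hθ1 Finset.univ
    (fun k : Fin r × Fin (2 ^ L) × Fin (2 ^ L) =>
      nodeCoeff ρ₁ (fun _ => 1) L k.1 k.2.1 k.2.2)
    (fun k => {Sum.inl k.1, Sum.inr (Sum.inl k.2.1), Sum.inr (Sum.inr k.2.2)}) (C := C) (by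
      intro t
      refine le_of_eq_of_le ?_ (hC t)
      congr 1
      unfold levelSum
      rw [← hsum]
      refine Finset.sum_congr rfl fun k _ => ?_
      rw [hprod, node_cpow]
      have hexp : ∀ q : ℕ, Complex.exp (-(Complex.I * (t * Real.log (kthPrime q) : ℝ))) =
          (kthPrime q : ℂ) ^ (-(t * Complex.I)) := by
        intro q
        rw [Complex.cpow_def_of_ne_zero (by exact_mod_cast (kthPrime_prime q).ne_zero)]
        congr 1
        push_cast
        ring
      simp only [hp, Sum.elim_inl, Sum.elim_inr, hexp])
  have e : ∑ k : Fin r × Fin (2 ^ L) × Fin (2 ^ L),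
      nodeCoeff ρ₁ (fun _ => 1) L k.1 k.2.1 k.2.2 * ∏ i ∈ ({Sum.inl k.1, Sum.inr (Sum.inl k.2.1),
        Sum.inr (Sum.inr k.2.2)} : Finset _), (θ i / 2) =
      (((2 : ℝ) ^ (-(2 * (ρ₁ + 2) / 3) * L) / 8 : ℝ) : ℂ) *
      ∑ i₁ ∈ Finset.range r, ∑ i₂ ∈ Finset.range (2 ^ L), ∑ i₃ ∈ Finset.range (2 ^ L),
        rootOfUnity (2 ^ L) ^ (i₁ * i₂) * rootOfUnity (2 ^ L) ^ (i₂ * i₃) *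
          (x i₁ * y i₂ * z i₃) := by
    rw [← hsum, Finset.mul_sum]
    refine Finset.sum_congr rfl fun k _ => ?_
    rw [hprod]
    simp only [hθ, Sum.elim_inl, Sum.elim_inr]
    unfold nodeCoeff
    push_cast
    ring
  rw [e, norm_mul, Complex.norm_real, Real.norm_eq_abs, abs_of_nonneg (by positivity),
    mul_comm _ (L : ℝ), Real.rpow_mul two_pos.le, Real.rpow_natCast] at key
  push_cast at hxyz
  refine le_trans ?_ key
  rw [mul_div_right_comm]
  gcongr

theorem tendsto_two_pow_rpow_atTop {a : ℝ} (ha : 0 < a) :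
    Tendsto (fun L : ℕ => ((2 : ℝ) ^ L) ^ a) atTop atTop :=
  (tendsto_rpow_atTop ha).comp (tendsto_pow_atTop_atTop_of_one_lt one_lt_two)

theorem eventually_exists_lt_norm_levelSum {ρ₁ : ℝ} (hρ0 : 0 < ρ₁) (hρ : ρ₁ < 1) (C : ℝ) :
    ∀ᶠ L in atTop, ∃ t : ℝ, C < ‖levelSum ρ₁ (t * Complex.I) L‖ := by
  -- This is the net exponent -X + 1 + (1 + ρ₁)/2 of the level. The root of the logarithm costs
  -- N^(ε/2), so N^(ε/2) remains.
  set ε : ℝ := (1 - ρ₁) / 6 with hε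
  have hε0 : 0 < ε := by rw [hε]; linarith
  set c : ℝ := √(3 + 2 / ε) with hc
  have hc0 : 0 < c := Real.sqrt_pos.2 (by positivity)
  filter_upwards [(tendsto_two_pow_rpow_atTop (half_pos hε0)).eventually_gt_atTop (16 * c * C),
    eventually_ge_atTop 1] with L hLC hL
  by_contra! hcon
  have h := le_of_forall_norm_levelSum_le hρ0.le hρ.le hL hcon
  set N : ℝ := (2 : ℝ) ^ L with hN
  have hN1 : 1 ≤ N := one_le_pow₀ one_le_two
  have hN0 : 0 < N := by positivity
  have hr0 : (0 : ℝ) < firstSize ρ₁ L := by exact_mod_cast firstSize_pos hρ0.le L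
  have h1 : 3 + 2 * Real.log (firstSize ρ₁ L) ≤ (3 + 2 / ε) * N ^ ε := by
    have hlog : Real.log (firstSize ρ₁ L) ≤ N ^ ε / ε := by
      refine le_trans (Real.log_le_log hr0 ?_) (Real.log_le_rpow_div hN0.le hε0)
      rw [hN]
      exact_mod_cast firstSize_le hρ.le L
    have := Real.one_le_rpow hN1 hε0.le
    calc _ ≤ 3 * N ^ ε + 2 * (N ^ ε / ε) := by linarith
      _ = _ := by ring
  have h2 : √(3 + 2 * Real.log (firstSize ρ₁ L)) ≤ c * N ^ (ε / 2) := by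
    calc _ ≤ √((3 + 2 / ε) * N ^ ε) := Real.sqrt_le_sqrt h1
      _ = _ := by
        rw [Real.sqrt_mul (by positivity), Real.sqrt_eq_rpow (N ^ ε), ← Real.rpow_mul hN0.le]
        congr 2; ring
  have h3 : N ^ ((1 + ρ₁) / 2) / 2 ≤ √(N * firstSize ρ₁ L) := by
    refine Real.le_sqrt_of_sq_le ?_
    have e : (N ^ ((1 + ρ₁) / 2) / 2) ^ 2 = N * (N ^ ρ₁ / 2) / 2 := by
      rw [div_pow, ← Real.rpow_natCast, ← Real.rpow_mul hN0.le]
      rw [show (1 + ρ₁) / 2 * ((2 : ℕ) : ℝ) = 1 + ρ₁ by push_cast; ring, Real.rpow_add hN0,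
        Real.rpow_one]
      ring
    rw [e]
    have h4 : N * (N ^ ρ₁ / 2) ≤ N * firstSize ρ₁ L := by
      gcongr; exact rpow_le_firstSize hρ0.le L
    have h5 : 0 ≤ N * (N ^ ρ₁ / 2) := by positivity
    linarith
  have hlog0 : 0 ≤ Real.log (firstSize ρ₁ L) := Real.log_natCast_nonneg _
  have hs0 : 0 < √(3 + 2 * Real.log (firstSize ρ₁ L)) := Real.sqrt_pos.2 (by positivity)
  have h6 : N ^ (ε / 2) / (16 * c) ≤ C := by
    refine le_trans ?_ h
    calc N ^ (ε / 2) / (16 * c) = N ^ (-(2 * (ρ₁ + 2) / 3)) * (N * (N ^ ((1 + ρ₁) / 2) / 2) /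
          (c * N ^ (ε / 2))) / 8 := by
          have e : N ^ (ε / 2) * N ^ (ε / 2) = N ^ (-(2 * (ρ₁ + 2) / 3)) * N ^ (1 : ℝ) *
              N ^ ((1 + ρ₁) / 2) := by
            simp only [← Real.rpow_add hN0]
            congr 1; rw [hε]; ring
          rw [Real.rpow_one] at e
          have hne : N ^ (ε / 2) ≠ 0 := by positivity
          field_simp
          linear_combination 16 * e
      _ ≤ _ := by gcongr
  rw [div_le_iff₀ (by positivity)] at h6
  linarith

/-- If every choice of signs gave a bounded function, Baire's theorem on the compact space of sign
sequences would give a uniform bound on a nonempty open set. Such a set leaves all but finitely many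
signs free, and flipping one far sign changes the sum by twice a level sum, which is too large. -/
theorem exists_not_bounded {ρ₁ : ℝ} (hρ0 : 0 < ρ₁) (hρ : ρ₁ < 1) :
    ∃ β : ℕ → ℂ, (∀ L, ‖β L‖ = 1) ∧ ∀ C : ℝ, ∃ t : ℝ,
      C < ‖∑' L : ℕ, β (L + 1) * levelSum ρ₁ (t * Complex.I) (L + 1)‖ := by
  set sgn : Bool → ℂ := fun b => if b then 1 else -1 with hsgn
  have hsgn1 : ∀ b, ‖sgn b‖ = 1 := by intro b; cases b <;> simp [hsgn]
  set F : (ℕ → Bool) → ℝ → ℂ := fun b t =>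
    ∑' L : ℕ, sgn (b (L + 1)) * levelSum ρ₁ (t * Complex.I) (L + 1) with hF
  suffices h : ∃ b, ∀ C : ℝ, ∃ t : ℝ, C < ‖F b t‖ by
    obtain ⟨b, hb⟩ := h
    exact ⟨fun L => sgn (b L), fun L => hsgn1 _, hb⟩
  by_contra! hcon
  -- For fixed t the majorant is uniform in the signs, so the sum is continuous in b and the sets in
  -- Baire's theorem are closed.
  have hdom : ∀ t : ℝ, ∃ u : ℕ → ℝ, Summable u ∧ ∀ (L : ℕ) (b : Bool),
      ‖sgn b * levelSum ρ₁ (t * Complex.I) (L + 1)‖ ≤ u L := by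
    intro t
    obtain ⟨K, q, h0, h1, h⟩ := exists_norm_levelSum_le (s := t * Complex.I) hρ.le
      (by simp; linarith)
    refine ⟨fun L => K * q ^ (L + 1), ?_, fun L b => ?_⟩
    · simp only [pow_succ, ← mul_assoc]
      exact ((summable_geometric_of_lt_one h0 h1).mul_left K).mul_right q
    · rw [norm_mul, hsgn1, one_mul]
      exact h _
  have hcont : ∀ t, Continuous fun b => F b t := by
    intro t
    obtain ⟨u, hu, hub⟩ := hdom t
    refine continuous_tsum (fun L => ?_) hu fun L b => hub L _
    have h1 : Continuous sgn := continuous_of_discreteTopology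
    exact (h1.comp (continuous_apply (L + 1))).mul continuous_const
  obtain ⟨n, hn⟩ := nonempty_interior_of_iUnion_of_closed
    (f := fun n : ℕ => {b : ℕ → Bool | ∀ t, ‖F b t‖ ≤ n})
    (fun n => by
      simp only [Set.ofPred_forall]
      exact isClosed_iInter fun t => isClosed_le (hcont t).norm continuous_const)
    (by
      refine Set.eq_univ_of_forall fun b => ?_
      obtain ⟨C, hC⟩ := hcon b
      obtain ⟨n, hn⟩ := exists_nat_ge C
      exact Set.mem_iUnion.2 ⟨n, fun t => (hC t).trans hn⟩)
  obtain ⟨b, hb⟩ := hn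
  obtain ⟨I, u, hu, hsub⟩ := isOpen_pi_iff.1 isOpen_interior b hb
  -- The level L + 1 lies beyond the finitely many coordinates I that fix the neighbourhood, so both
  -- b and its flip at L + 1 obey the bound n.
  obtain ⟨L, ⟨t, ht⟩, hLI⟩ := ((tendsto_add_atTop_nat 1).eventually
    ((eventually_exists_lt_norm_levelSum hρ0 hρ n).and
      (eventually_gt_atTop (I.sup id)))).exists
  have hmem : ∀ c, (∀ i ∈ I, c i = b i) → ‖F c t‖ ≤ n := fun c hc => by
    have : c ∈ interior {b : ℕ → Bool | ∀ t, ‖F b t‖ ≤ n} :=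
      hsub fun i hi => by rw [hc i hi]; exact (hu i hi).2
    exact interior_subset this t
  set b' := Function.update b (L + 1) (!b (L + 1)) with hb'
  have h1 := hmem b fun _ _ => rfl
  have h2 := hmem b' fun i hi => by
    rw [hb', Function.update_of_ne]
    rintro rfl
    have := Finset.le_sup (f := id) hi
    simp only [id] at this hLI
    omega
  obtain ⟨v, hv, hvb⟩ := hdom t
  have hdiff : F b t - F b' t = (sgn (b (L + 1)) - sgn (!b (L + 1))) *
      levelSum ρ₁ (t * Complex.I) (L + 1) := by
    simp only [hF]
    rw [← Summable.tsum_sub (hv.of_norm_bounded fun L => hvb L _)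
      (hv.of_norm_bounded fun L => hvb L _), tsum_eq_single L]
    · rw [hb', Function.update_self, sub_mul]
    · intro k hk
      rw [hb', Function.update_of_ne (by omega), sub_self]
  have h3 : ‖sgn (b (L + 1)) - sgn (!b (L + 1))‖ = 2 := by
    cases b (L + 1) <;> simp [hsgn] <;> norm_num
  have h4 := norm_sub_le (F b t) (F b' t)
  rw [hdiff, norm_mul, h3] at h4
  linarith

/-! ### Homogeneity and the abscissae -/

theorem coeff_eq_zero_or_exists (ρ₁ : ℝ) (β : ℕ → ℂ) (n : ℕ) : coeff ρ₁ β n = 0 ∨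
    ∃ L i₁ i₂ i₃, 1 ≤ L ∧ i₁ < firstSize ρ₁ L ∧ i₂ < 2 ^ L ∧ i₃ < 2 ^ L ∧
      n = node L i₁ i₂ i₃ := by
  by_contra! h
  exact h.1 (coeff_eq_zero β h.2)

theorem cardFactors_node (L i₁ i₂ i₃ : ℕ) :
    ArithmeticFunction.cardFactors (node L i₁ i₂ i₃) = 3 := by
  unfold node
  rw [ArithmeticFunction.cardFactors_mul (Nat.mul_ne_zero (kthPrime_prime _).ne_zero
    (kthPrime_prime _).ne_zero) (kthPrime_prime _).ne_zero,
    ArithmeticFunction.cardFactors_mul (kthPrime_prime _).ne_zero (kthPrime_prime _).ne_zero,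
    ArithmeticFunction.cardFactors_apply_prime (kthPrime_prime _),
    ArithmeticFunction.cardFactors_apply_prime (kthPrime_prime _),
    ArithmeticFunction.cardFactors_apply_prime (kthPrime_prime _)]

theorem isHomogeneous_coeff (ρ₁ : ℝ) (β : ℕ → ℂ) : IsHomogeneous 3 (coeff ρ₁ β) := by
  intro n hn
  obtain ⟨L, i, j, k, -, -, -, -, rfl⟩ := (coeff_eq_zero_or_exists ρ₁ β n).resolve_left hn
  exact ⟨(node_pos L i j k).ne', cardFactors_node L i j k⟩

theorem norm_coeff_le_one {ρ₁ : ℝ} (hρ0 : 0 ≤ ρ₁) (hρ : ρ₁ ≤ 1) {β : ℕ → ℂ}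
    (hβ : ∀ L, ‖β L‖ = 1) (n : ℕ) : ‖coeff ρ₁ β n‖ ≤ 1 := by
  rcases coeff_eq_zero_or_exists ρ₁ β n with h | ⟨L, i, j, k, hL, hi, hj, hk, rfl⟩
  · simp [h]
  · rw [coeff_node hρ β hL hi hj hk, norm_nodeCoeff ρ₁ (hβ L)]
    exact Real.rpow_le_one_of_one_le_of_nonpos (one_le_pow₀ one_le_two)
      (by linarith)

theorem exists_real_sInf_eq {S : Set ℝ} {a c : ℝ} (ha : ∀ x ∈ S, a ≤ x) (hc : ∀ y, c < y → y ∈ S) :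
    ∃ σ : ℝ, sInf (Real.toEReal '' S) = (σ : EReal) ∧ a ≤ σ ∧ σ ≤ c := by
  have h1 : (a : EReal) ≤ sInf (Real.toEReal '' S) := by
    refine le_sInf ?_
    rintro _ ⟨x, hx, rfl⟩
    exact_mod_cast ha x hx
  have h2 : sInf (Real.toEReal '' S) ≤ (c : EReal) := by
    refine EReal.le_of_forall_lt_iff_le.1 fun y hy => sInf_le ⟨y, hc y (by exact_mod_cast hy), rfl⟩
  have h3 : sInf (Real.toEReal '' S) ≠ ⊥ := fun h => by simp [h] at h1
  have h4 : sInf (Real.toEReal '' S) ≠ ⊤ := fun h => by simp [h] at h2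
  refine ⟨(sInf (Real.toEReal '' S)).toReal, (EReal.coe_toReal h4 h3).symm, ?_, ?_⟩
  · rw [← EReal.coe_le_coe_iff, EReal.coe_toReal h4 h3]; exact h1
  · rw [← EReal.coe_le_coe_iff, EReal.coe_toReal h4 h3]; exact h2

/-- A single level already contributes at least a constant times N^(ρ₁ + 2 - X - 3(x + ε)) to the
sum of moduli. If x lay 2ε below (ρ₁ + 2)/9, this would be N^(3ε), which is unbounded in L. -/
theorem le_of_lseriesSummable {ρ₁ : ℝ} (hρ0 : 0 ≤ ρ₁) (hρ : ρ₁ ≤ 1) {β : ℕ → ℂ}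
    (hβ : ∀ L, ‖β L‖ = 1) {x : ℝ} (hx : LSeriesSummable (coeff ρ₁ β) x) : (ρ₁ + 2) / 9 ≤ x := by
  by_contra! hlt
  set ε : ℝ := ((ρ₁ + 2) / 9 - x) / 2 with hε
  have hε0 : 0 < ε := by rw [hε]; linarith
  obtain ⟨C, hC, hCu⟩ := exists_rpow_le x hε0
  set S : ℝ := ∑' n, ‖LSeries.term (coeff ρ₁ β) x n‖ with hS
  obtain ⟨L, hLS, hL⟩ := (((tendsto_two_pow_rpow_atTop (a := 3 * ε) (by positivity)).eventually_gt_atTop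
    (2 * C ^ 3 * S)).and (eventually_ge_atTop 1)).exists
  set N : ℝ := (2 : ℝ) ^ L with hN
  have hN0 : 0 < N := by positivity
  set r := firstSize ρ₁ L with hr
  have hrN : r ≤ 2 ^ L := firstSize_le hρ L
  set T : Finset (ℕ × ℕ × ℕ) :=
    Finset.range r ×ˢ Finset.range (2 ^ L) ×ˢ Finset.range (2 ^ L) with hT
  have hTm : ∀ k ∈ T, k.1 < r ∧ k.2.1 < 2 ^ L ∧ k.2.2 < 2 ^ L := by
    intro k hk
    simpa [hT] using hk
  set f : ℕ × ℕ × ℕ → ℕ := fun k => node L k.1 k.2.1 k.2.2 with hf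
  have hinj : Set.InjOn f T := by
    intro k hk l hl h
    obtain ⟨k1, k2, k3⟩ := hTm k hk
    obtain ⟨l1, l2, l3⟩ := hTm l hl
    obtain ⟨-, h1, h2, h3⟩ := node_inj (k1.trans_le hrN) k2 k3 (l1.trans_le hrN) l2 l3 h
    exact Prod.ext h1 (Prod.ext h2 h3)
  have hle : ∑ k ∈ T, ‖LSeries.term (coeff ρ₁ β) x (f k)‖ ≤ S := by
    rw [← Finset.sum_image (f := fun n => ‖LSeries.term (coeff ρ₁ β) x n‖) hinj]
    exact Summable.sum_le_tsum _ (fun _ _ => norm_nonneg _) hx.norm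
  have hprime : ∀ k, 2 ^ L ≤ k → k ≤ 6 * 2 ^ L → (kthPrime k : ℝ) ^ x ≤ C * N ^ (x + ε) :=
    fun k h1 h2 => hCu L _ (two_pow_le_kthPrime h1) (kthPrime_le_of_le h2)
  have hterm : ∀ k ∈ T, N ^ (-(2 * (ρ₁ + 2) / 3)) / (C * N ^ (x + ε)) ^ 3 ≤
      ‖LSeries.term (coeff ρ₁ β) x (f k)‖ := by
    intro k hk
    obtain ⟨k1, k2, k3⟩ := hTm k hk
    have hpos := node_pos L k.1 k.2.1 k.2.2
    rw [LSeries.norm_term_eq, if_neg hpos.ne', hf, coeff_node hρ β hL k1 k2 k3,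
      norm_nodeCoeff ρ₁ (hβ L), Complex.ofReal_re]
    have k1' := k1.trans_le hrN
    have e : ((node L k.1 k.2.1 k.2.2 : ℕ) : ℝ) ^ x = (kthPrime (3 * 2 ^ L + k.1) : ℝ) ^ x *
        (kthPrime (4 * 2 ^ L + k.2.1) : ℝ) ^ x * (kthPrime (5 * 2 ^ L + k.2.2) : ℝ) ^ x := by
      unfold node
      push_cast
      rw [Real.mul_rpow (by positivity) (by positivity), Real.mul_rpow (by positivity)
        (by positivity)]
    have hnode : ((node L k.1 k.2.1 k.2.2 : ℕ) : ℝ) ^ x ≤ (C * N ^ (x + ε)) ^ 3 := by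
      rw [e, pow_three, ← mul_assoc]
      gcongr
      · exact hprime _ (by omega) (by omega)
      · exact hprime _ (by omega) (by omega)
      · exact hprime _ (by omega) (by omega)
    have : (0 : ℝ) < ((node L k.1 k.2.1 k.2.2 : ℕ) : ℝ) ^ x :=
      Real.rpow_pos_of_pos (by exact_mod_cast hpos) _
    gcongr
  have hcard : (T.card : ℝ) = r * (N * N) := by
    simp [hT, hN]
  have h1 := (Finset.card_nsmul_le_sum T _ _ hterm).trans hle
  rw [nsmul_eq_mul, hcard] at h1
  have h2 : N ^ ρ₁ / 2 * (N * N) * (N ^ (-(2 * (ρ₁ + 2) / 3)) / (C * N ^ (x + ε)) ^ 3) ≤ S := by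
    refine le_trans ?_ h1
    gcongr
    exact rpow_le_firstSize hρ0 L
  have h3 : N ^ (3 * ε) = N ^ ρ₁ * (N * N) * N ^ (-(2 * (ρ₁ + 2) / 3)) / (N ^ (x + ε)) ^ 3 := by
    rw [eq_div_iff (by positivity), ← Real.rpow_natCast, ← Real.rpow_mul hN0.le]
    nth_rewrite 4 [← Real.rpow_one N]
    nth_rewrite 5 [← Real.rpow_one N]
    simp only [← Real.rpow_add hN0]
    congr 1
    rw [hε]; push_cast; ring
  have h4 : N ^ ρ₁ / 2 * (N * N) * (N ^ (-(2 * (ρ₁ + 2) / 3)) / (C * N ^ (x + ε)) ^ 3) =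
      N ^ (3 * ε) / (2 * C ^ 3) := by
    rw [h3]; field_simp
  rw [h4, div_le_iff₀ (by positivity)] at h2
  linarith

/-- A crude bound that keeps σ_c away from -∞: at s = -X the general term has modulus at least 1 at
`node L 0 0 0` for every L ≥ 1, so it does not tend to zero. -/
theorem le_of_forall_tendsto {ρ₁ : ℝ} (hρ0 : 0 ≤ ρ₁) (hρ : ρ₁ ≤ 1) {β : ℕ → ℂ}
    (hβ : ∀ L, ‖β L‖ = 1) {σ : ℝ} (hσ : ∀ s : ℂ, σ < s.re →
      ∃ l : ℂ, Tendsto (partialSum (coeff ρ₁ β) s) atTop (𝓝 l)) : -(2 * (ρ₁ + 2) / 3) ≤ σ := by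
  by_contra! hlt
  set X : ℝ := 2 * (ρ₁ + 2) / 3 with hX
  have hX0 : 0 ≤ X := by positivity
  obtain ⟨l, hl⟩ := hσ ((-X : ℝ) : ℂ) (by simpa using hlt)
  have h1 : Tendsto (fun n => coeff ρ₁ β (n + 1) * ((n + 1 : ℕ) : ℂ) ^ (-((-X : ℝ) : ℂ))) atTop
      (𝓝 0) := by
    have h2 := ((tendsto_add_atTop_iff_nat 1).2 hl).sub hl
    rw [sub_self] at h2
    refine h2.congr fun n => ?_
    unfold partialSum
    rw [Finset.sum_Icc_succ_top (by omega), add_sub_cancel_left]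
  have h3 : Tendsto (fun n => ‖coeff ρ₁ β n * (n : ℂ) ^ (-((-X : ℝ) : ℂ))‖) atTop (𝓝 0) := by
    rw [← tendsto_add_atTop_iff_nat 1]
    simpa using h1.norm
  obtain ⟨n₀, hn₀⟩ := eventually_atTop.1 (h3.eventually_lt_const one_pos)
  set L := n₀ + 1 with hL
  have hN0 : 0 < 2 ^ L := Nat.two_pow_pos L
  have h4 := hn₀ (node L 0 0 0) (by have := le_node L 0 0 0; omega)
  have hpos := node_pos L 0 0 0
  have hnode : (2 : ℝ) ^ L ≤ node L 0 0 0 := by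
    have h5 : 2 ^ L ≤ node L 0 0 0 := by
      calc 2 ^ L ≤ kthPrime (3 * 2 ^ L + 0) := le_trans (by omega) (le_kthPrime _)
        _ ≤ _ := Nat.le_mul_of_pos_right _ (kthPrime_prime _).pos
        _ ≤ _ := Nat.le_mul_of_pos_right _ (kthPrime_prime _).pos
    exact_mod_cast h5
  rw [coeff_node hρ β (by omega) (firstSize_pos hρ0 L) hN0 hN0, norm_mul,
    norm_nodeCoeff ρ₁ (hβ L), Complex.norm_natCast_cpow_of_pos hpos, Complex.neg_re,
    Complex.ofReal_re, neg_neg, ← hX] at h4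
  have h6 : ((2 : ℝ) ^ L) ^ (-X) * ((2 : ℝ) ^ L) ^ X ≤
      ((2 : ℝ) ^ L) ^ (-X) * (node L 0 0 0 : ℝ) ^ X := by gcongr
  rw [← Real.rpow_add (by positivity), neg_add_cancel, Real.rpow_zero] at h6
  linarith

theorem exists_bound_of_lt {ρ₁ : ℝ} (hρ : ρ₁ ≤ 1) {β : ℕ → ℂ} (hβ : ∀ L, ‖β L‖ = 1) {σ : ℝ}
    (hσ : (1 - ρ₁) / 18 < σ) : ∃ (f : ℂ → ℂ) (C : ℝ), ∀ s : ℂ, σ < s.re →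
      Tendsto (partialSum (coeff ρ₁ β) s) atTop (𝓝 (f s)) ∧ ‖f s‖ ≤ C := by
  set q : ℝ := (2 : ℝ) ^ ((1 - ρ₁) / 6 - 3 * σ) with hq
  have hq0 : 0 ≤ q := by positivity
  have hq1 : q < 1 := Real.rpow_lt_one_of_one_lt_of_neg one_lt_two (by linarith)
  have hsum : Summable fun L : ℕ => q ^ (L + 1) := by
    simp only [pow_succ]
    exact (summable_geometric_of_lt_one hq0 hq1).mul_right q
  refine ⟨fun s => ∑' L : ℕ, β (L + 1) * levelSum ρ₁ s (L + 1), ∑' L : ℕ, q ^ (L + 1),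
    fun s hs => ⟨tendsto_partialSum_coeff hρ hβ (by linarith), ?_⟩⟩
  refine tsum_of_norm_bounded hsum.hasSum fun L => ?_
  rw [norm_mul, hβ, one_mul]
  exact norm_levelSum_le hρ (by linarith) hs.le _

/-- For σ < 0 the imaginary axis lies inside the half-plane, where by uniqueness of limits f is the
unbounded sum over levels. -/
theorem nonneg_of_bounded {ρ₁ : ℝ} (hρ : ρ₁ < 1) {β : ℕ → ℂ} (hβ : ∀ L, ‖β L‖ = 1)
    (hunb : ∀ C : ℝ, ∃ t : ℝ,
      C < ‖∑' L : ℕ, β (L + 1) * levelSum ρ₁ (t * Complex.I) (L + 1)‖)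
    {σ : ℝ} {f : ℂ → ℂ} {C : ℝ} (h : ∀ s : ℂ, σ < s.re →
      Tendsto (partialSum (coeff ρ₁ β) s) atTop (𝓝 (f s)) ∧ ‖f s‖ ≤ C) : 0 ≤ σ := by
  by_contra! hσ
  obtain ⟨t, ht⟩ := hunb C
  have h1 := h (t * Complex.I) (by simpa using hσ)
  have h2 := tendsto_partialSum_coeff (s := t * Complex.I) hρ.le hβ (by simp; linarith)
  rw [tendsto_nhds_unique h2 h1.1] at ht
  exact absurd h1.2 (not_le.2 ht)

end BohrStrip


theorem mainTheorem2 (ρ₁ : ℝ) (hρ₀ : 0 < ρ₁) (hρ₁ : ρ₁ < 1) :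
    ∃ β : ℕ → ℂ, (∀ L : ℕ, ‖β L‖ = 1) ∧
      BohrStrip.IsHomogeneous 3 (BohrStrip.coeff ρ₁ β) ∧
      ∃ σa σb σc : ℝ,
        LSeries.abscissaOfAbsConv (BohrStrip.coeff ρ₁ β) = (σa : EReal) ∧
        BohrStrip.abscissaOfBdd (BohrStrip.coeff ρ₁ β) = (σb : EReal) ∧
        BohrStrip.abscissaOfConv (BohrStrip.coeff ρ₁ β) = (σc : EReal) ∧
        (0 ≤ σb ∧ σb ≤ (1 - ρ₁) / 18) ∧
        (ρ₁ + 2) / 9 ≤ σa ∧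
        σc ≤ (ρ₁ - 1) / 9 ∧
        1 / 3 ≤ σa - σc ∧
        (1 + ρ₁) / 6 ≤ σa - σb ∧
        (1 - ρ₁) / 9 ≤ σb - σc ∧
        (1 / 2 < ρ₁ → 1 / 4 < σa - σb) := by
  obtain ⟨β, hβ, hunb⟩ := BohrStrip.exists_not_bounded hρ₀ hρ₁
  -- The upper bound 1, from bounded coefficients, serves only to make σ_a finite.
  obtain ⟨σa, ha, ha1, -⟩ := BohrStrip.exists_real_sInf_eq
    (S := {x : ℝ | LSeriesSummable (BohrStrip.coeff ρ₁ β) x}) (c := 1)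
    (fun x hx => BohrStrip.le_of_lseriesSummable hρ₀.le hρ₁.le hβ hx)
    (fun y hy => LSeriesSummable_of_bounded_of_one_lt_re
      (fun n _ => BohrStrip.norm_coeff_le_one hρ₀.le hρ₁.le hβ n) (by simpa using hy))
  obtain ⟨σb, hb, hb1, hb2⟩ := BohrStrip.exists_real_sInf_eq
    (S := {σ : ℝ | ∃ (f : ℂ → ℂ) (C : ℝ), ∀ s : ℂ, σ < s.re →
      Tendsto (BohrStrip.partialSum (BohrStrip.coeff ρ₁ β) s) atTop (𝓝 (f s)) ∧ ‖f s‖ ≤ C})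
    (fun x ⟨f, C, h⟩ => BohrStrip.nonneg_of_bounded hρ₁ hβ hunb h)
    (fun y hy => BohrStrip.exists_bound_of_lt hρ₁.le hβ hy)
  obtain ⟨σc, hc, -, hc2⟩ := BohrStrip.exists_real_sInf_eq
    (S := {σ : ℝ | ∀ s : ℂ, σ < s.re →
      ∃ l : ℂ, Tendsto (BohrStrip.partialSum (BohrStrip.coeff ρ₁ β) s) atTop (𝓝 l)})
    (fun x hx => BohrStrip.le_of_forall_tendsto hρ₀.le hρ₁.le hβ hx)
    (fun y (hy : (ρ₁ - 1) / 9 < y) s hs =>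
      ⟨_, BohrStrip.tendsto_partialSum_coeff hρ₁.le hβ (hy.trans hs)⟩)
  exact ⟨β, hβ, BohrStrip.isHomogeneous_coeff ρ₁ β, σa, σb, σc, ha, hb, hc, ⟨hb1, hb2⟩, ha1, hc2,
    by linarith, by linarith, by linarith, fun h => by linarith⟩
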